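/- Let $\Phi$ be a (non-empty) irreducible reduced crystallographic root system with Weyl group $W_0$, positive roots $\Phi^+$, simple roots $\Delta$, longest element $w_0\in W_0$, and let $\rho$ be the weight with $\langle\alpha^\vee,\rho\rangle=1$ for all $\alpha\in\Delta$. Let $X$ be an abelian group (torsion and a central part are allowed) with an additive action of $W_0$, containing the coroots $\alpha^\vee$, and on which every $\alpha\in\Phi$ defines an integer-valued functional $\lambda\mapsto\langle\lambda,\alpha\rangle$, such that $\langle\beta^\vee,\alpha\rangle$ is the Cartan integer, $w(\alpha^\vee)=(w\alpha)^\vee$, $\langle w\lambda,w\alpha\rangle=\langle\lambda,\alpha\rangle$, and the reflection $s_\alpha$ acts by $\lambda\mapsto\lambda-\langle\lambda,\alpha\rangle\alpha^\vee$. (For a connected reductive group over a non-archimedean local field, with maximal torus $T$ as usual and inertia group $\Gamma_0$, one takes $X=X_*(T)_{\Gamma_0}$, and $\Phi$ is the reduced root system for which the $\alpha+k$, $\alpha\in\Phi$, $k\in\mathbb Z$, are the affine roots at the chosen special vertex.) Let $\tilde W=X\rtimes W_0=\{t^\lambda w\}$, with length function $\ell$ (the number of affine root hyperplanes separating the base alcove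 from its image, where the base alcove is the one in the dominant chamber whose closure contains the origin and $t^\lambda$ acts by translation by $\lambda$) and Bruhat order $\leq$ (generated by $u<ur$ for affine reflections $r=t^{k\alpha^\vee}s_\alpha$ with $\ell(u)<\ell(ur)$). For $\mu\in X$ put $\mathrm{Adm}(\mu)=\{w\in\tilde W: w\leq t^{x(\mu)}\text{ for some }x\in W_0\}$. Call $\lambda\in X$ dominant if $\langle\lambda,\alpha\rangle\geq0$ for all $\alpha\in\Delta$, write $\lambda\leq\lambda'$ if $\lambda'-\lambda$ is a sum of simple coroots, and put $\mathrm{depth}(\lambda)=\min\{\langle\lambda,\alpha\rangle:\alpha\in\Delta\}$. The quantum Bruhat graph has vertex set $W_0$ and, for $w\in W_0$ and $\alpha\in\Phi^+$, an upward edge $w\to ws_\alpha$ of weight $0$ if $\ell(ws_\alpha)=\ell(w)+1$, and a downward edge $w\to ws_\alpha$ of weight $\alpha^\vee$ if $\ell(ws_\alpha)=\ell(w)-\langle\alpha^\vee,2\rho\rangle+1$. The weight of a path (possibly of length $0$) is the sum in $X$ of the weights of its edges. Let $\lambda,\mu\in X$ be dominant. Suppose that every dominant $\lambda'\in X$ with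 $\lambda\leq\lambda'\leq\mu$ satisfies $\mathrm{depth}(\lambda')\geq 2\ell(w_0)+2$ if $\Phi$ is not of type $G_2$, and $\mathrm{depth}(\lambda')\geq 3\ell(w_0)+3$ if $\Phi$ is of type $G_2$. Then for all $x,y\in W_0$, the element $xt^\lambda y$ lies in $\mathrm{Adm}(\mu)$ if and only if the quantum Bruhat graph has a path from $x$ to $y^{-1}$ of weight $\mu-\lambda$. -/

import Mathlib

/-! # Extended affine Weyl groups, admissible sets and quantum Bruhat graphs -/

noncomputable section

section Finite

variable {ι V V' : Type*} [AddCommGroup V] [Module ℚ V] [AddCommGroup V'] [Module ℚ V']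
variable {P : RootPairing ι ℚ V V'}

/-- The length of an element `w` of the finite Weyl group `W₀`: the number of positive roots that
`w` makes negative. -/
def RootPairing.Base.length (b : P.Base) (w : P.weylGroup) : ℕ :=
  {i : ι | b.IsPos i ∧ ¬ b.IsPos (P.weylGroupToPerm w i)}.ncard

/-- `w₀` is the longest element of the finite Weyl group. -/
def RootPairing.Base.IsLongest (b : P.Base) (w₀ : P.weylGroup) : Prop :=
  ∀ w : P.weylGroup, b.length w ≤ b.length w₀

/-- The number `⟨α^∨, ρ⟩`, where `ρ` is the weight with `⟨β^∨, ρ⟩ = 1` for all simple `β`. It is the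
sum of the coefficients of `α^∨` in the basis of simple coroots; see
`RootPairing.Base.coroot_rho_eq`. -/
def RootPairing.Base.corootRho (b : P.Base) (i : ι) : ℤ :=
  b.flip.height i

theorem RootPairing.Base.coroot_rho_eq (b : P.Base) (ρ : V)
    (hρ : ∀ i ∈ b.support, P.coroot' i ρ = 1) (i : ι) :
    P.coroot' i ρ = (b.corootRho i : ℚ) := by
  obtain ⟨f, -, -, hf⟩ := b.flip.exists_root_eq_sum_int i
  have h : b.corootRho i = ∑ j ∈ b.support, f j := RootPairing.Base.height_eq_sum (b := b.flip) hf
  rw [h]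
  have hf' : P.coroot i = ∑ j ∈ b.support, f j • P.coroot j := hf
  have : P.coroot' i ρ = ∑ j ∈ b.support, (f j : ℚ) * P.coroot' j ρ := by
    simp only [RootPairing.coroot', LinearMap.flip_apply]
    rw [hf', map_sum]
    exact Finset.sum_congr rfl fun j _ => by rw [map_zsmul, zsmul_eq_mul]
  rw [this, Int.cast_sum]
  exact Finset.sum_congr rfl fun j hj => by rw [hρ j hj, mul_one]

open Classical in
/-- The bound `2 ℓ(w₀) + 2`, respectively `3 ℓ(w₀) + 3` for a root system of type `G₂`. -/
def RootPairing.Base.depthBound (b : P.Base) (w₀ : P.weylGroup) : ℤ :=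
  if P.IsG2 then 3 * (b.length w₀ : ℤ) + 3 else 2 * (b.length w₀ : ℤ) + 2

end Finite

/-- A group of translations for the root system `P` with Weyl group `W₀`: an abelian group `X`
(which may have torsion and may contain a central part) with an additive action of `W₀`,
containing the coroots, and on which the roots are integer-valued functionals, such that the
reflection `s_α` acts by `x ↦ x - ⟨x, α⟩ α^∨`.

If `X` is free of finite rank, this is a root datum with cocharacter lattice `X` and root system
`P`. For a connected reductive group over a local field with maximal torus `T` and inertia group
`Γ₀`, the coinvariants `X_*(T)_{Γ₀}` carry such a structure, `P` being the reduced root system whose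
affine roots `α + k`, `k ∈ ℤ`, are those of the apartment at a special vertex. -/
structure CocharacterDatum {ι V V' : Type*} [AddCommGroup V] [Module ℚ V]
    [AddCommGroup V'] [Module ℚ V'] (P : RootPairing ι ℚ V V') [P.IsCrystallographic]
    (X : Type*) [AddCommGroup X] [DistribMulAction P.weylGroup X] where
  /-- The coroot `α^∨` as an element of `X`. -/
  coroot : ι → X
  /-- The functional `x ↦ ⟨x, α⟩` on `X`. -/
  root : ι → X →+ ℤ
  root_coroot : ∀ i j, root i (coroot j) = P.pairingIn ℤ i j
  reflection_smul : ∀ i x, RootPairing.weylGroup.ofIdx P i • x = x - root i x • coroot i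
  smul_coroot : ∀ (w : P.weylGroup) i, w • coroot i = coroot (P.weylGroupToPerm w i)
  root_smul : ∀ (w : P.weylGroup) i x, root (P.weylGroupToPerm w i) (w • x) = root i x

namespace CocharacterDatum

variable {ι V V' X : Type*} [AddCommGroup V] [Module ℚ V] [AddCommGroup V'] [Module ℚ V']
variable {P : RootPairing ι ℚ V V'} [P.IsCrystallographic]
variable [AddCommGroup X] [DistribMulAction P.weylGroup X]

/-- The action of `W₀` on `X`, with `X` written multiplicatively. -/
def actionHom (P : RootPairing ι ℚ V V') (X : Type*) [AddCommGroup X]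
    [DistribMulAction P.weylGroup X] : P.weylGroup →* MulAut (Multiplicative X) where
  toFun w := AddEquiv.toMultiplicative (DistribMulAction.toAddEquiv X w)
  map_one' := by
    ext x
    exact congrArg Multiplicative.ofAdd (one_smul P.weylGroup x.toAdd)
  map_mul' v w := by
    ext x
    exact congrArg Multiplicative.ofAdd (mul_smul v w x.toAdd)

/-- The extended affine Weyl group `X ⋊ W₀`. -/
abbrev ExtWeyl (_D : CocharacterDatum P X) : Type _ :=
  Multiplicative X ⋊[actionHom P X] P.weylGroup

variable (D : CocharacterDatum P X) (b : P.Base)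

/-- The translation element `t^x`. -/
def t (x : X) : D.ExtWeyl := SemidirectProduct.inl (Multiplicative.ofAdd x)

/-- The inclusion of the finite Weyl group. -/
def fin (w : P.weylGroup) : D.ExtWeyl := SemidirectProduct.inr w

/-- A pair `(α, k)` stands for the affine root `v ↦ ⟨v, α⟩ + k`. It is positive if it takes positive
values on the base alcove, that is the alcove in the dominant chamber whose closure contains the
origin. -/
def IsPosAffine (a : ι × ℤ) : Prop :=
  (b.IsPos a.1 ∧ 0 ≤ a.2) ∨ (¬ b.IsPos a.1 ∧ 1 ≤ a.2)

/-- The action on affine roots: `t^x w` acts on affine functions by `f ↦ f ∘ (t^x w)⁻¹`, where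
`t^x` acts by translation by `x`; thus `(α, k) ↦ (w α, k - ⟨x, w α⟩)`. -/
def actAffine (u : D.ExtWeyl) (a : ι × ℤ) : ι × ℤ :=
  (P.weylGroupToPerm u.right a.1,
    a.2 - D.root (P.weylGroupToPerm u.right a.1) (Multiplicative.toAdd u.left))

/-- The length function on the extended affine Weyl group: the number of positive affine roots
made negative, equivalently of affine root hyperplanes which separate the base alcove from its
image. -/
def length (u : D.ExtWeyl) : ℕ :=
  {a : ι × ℤ | IsPosAffine b a ∧ ¬ IsPosAffine b (D.actAffine u a)}.ncard

/-- The affine reflection `t^{k α^∨} s_α`. -/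
def affineReflection (i : ι) (k : ℤ) : D.ExtWeyl :=
  D.t (k • D.coroot i) * D.fin (RootPairing.weylGroup.ofIdx P i)

/-- The Bruhat order on the extended affine Weyl group: the reflexive and transitive closure of
`u < u r` for affine reflections `r` with `ℓ(u) < ℓ(u r)`. -/
def BruhatLE : D.ExtWeyl → D.ExtWeyl → Prop :=
  Relation.ReflTransGen fun u v =>
    ∃ (i : ι) (k : ℤ), v = u * D.affineReflection i k ∧ D.length b u < D.length b v

/-- The admissible set of `μ`: all elements below some `t^{x(μ)}` with `x ∈ W₀`. -/
def Adm (μ : X) : Set D.ExtWeyl :=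
  {u | ∃ x : P.weylGroup, D.BruhatLE b u (D.t (x • μ))}

/-- Dominant elements of `X`. -/
def IsDominant (x : X) : Prop := ∀ i ∈ b.support, 0 ≤ D.root i x

/-- The dominance order: `x ≤ y` if `y - x` is a sum of simple coroots. -/
def DomLE (x y : X) : Prop := y - x ∈ AddSubmonoid.closure (D.coroot '' (b.support : Set ι))

/-- The depth of `x`: the minimum of `⟨x, α⟩` over the simple roots `α`. -/
def depth (x : X) : ℤ := ⨅ i : b.support, D.root i x

/-- `D.QBGPath b x y γ` says that there is a path of weight `γ` from `x` to `y` in the quantum Bruhat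
graph. Its edges are `w ⇀ w s_α` (upward, weight `0`) for positive roots `α` with
`ℓ(w s_α) = ℓ(w) + 1`, and `w ⇁ w s_α` (downward, weight `α^∨`) for positive roots `α` with
`ℓ(w s_α) = ℓ(w) - ⟨α^∨, 2ρ⟩ + 1`. -/
inductive QBGPath : P.weylGroup → P.weylGroup → X → Prop
  | nil (x : P.weylGroup) : QBGPath x x 0
  | up {x w : P.weylGroup} {γ : X} (i : ι) (p : QBGPath x w γ) (hi : b.IsPos i)
      (h : b.length (w * RootPairing.weylGroup.ofIdx P i) = b.length w + 1) :
      QBGPath x (w * RootPairing.weylGroup.ofIdx P i) γ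
  | down {x w : P.weylGroup} {γ : X} (i : ι) (p : QBGPath x w γ) (hi : b.IsPos i)
      (h : (b.length (w * RootPairing.weylGroup.ofIdx P i) : ℤ) =
        (b.length w : ℤ) - 2 * b.corootRho i + 1) :
      QBGPath x (w * RootPairing.weylGroup.ofIdx P i) (γ + D.coroot i)

end CocharacterDatum

end

/-! Every element of the extended affine Weyl group has the form `x t^l y` with `l` dominant. For
regular `l` its length is `⟨l, 2ρ⟩ + ℓ(x) - ℓ(y⁻¹)` (`length_formula`). Multiplying by a
length-decreasing affine reflection moves the translation part along a segment from `l'` to `s_α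
l'`, so the dominant part can only go down in the dominance order (`domLE_of_segment`). For a cover
the length formula allows `⟨l' - l, 2ρ⟩ ≤ 2ℓ(w₀) + 1`, so the new point lies near one end of the
segment. The depth hypothesis keeps that neighbourhood of the end inside a Weyl chamber. Hence just
one of `x`, `y` changes, and comparing lengths shows that the change is an edge of the quantum
Bruhat graph of weight `l' - l` (`qbgPath_of_cov`).

A saturated chain from `x t^λ y` up to `t^{zμ} = z t^μ z⁻¹` thus gives edges that extend a path at
`x` or at `y⁻¹`; they join at `z` and their weights add up to `μ - λ` (`qbgPath_of_chain`).
Saturated chains exist by the chain property of the Bruhat order (`reflTransGen_cov`), which rests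
on the lifting property `lift_chain`. Conversely, a path from `x` to `y⁻¹` is followed on the left
factor alone. Each edge raises the length by one, and the end is `y⁻¹ t^μ y = t^{y⁻¹μ}`
(`bruhatLE_of_qbgPath`). -/

noncomputable section
open RootPairing
set_option linter.unusedSectionVars false

namespace RootPairing

/-! ### The finite Weyl group: exchange, length, and pairings with 2ρ. -/

section Perm

variable {ι V V' : Type*} [AddCommGroup V] [Module ℚ V] [AddCommGroup V'] [Module ℚ V']
variable (P : RootPairing ι ℚ V V')

theorem weylGroupToPerm_ofIdx (i j : ι) :
    P.weylGroupToPerm (weylGroup.ofIdx P i) j = P.reflectionPerm i j := rfl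

theorem weylGroup_ext {u v : P.weylGroup} (h : ∀ x : V, u • x = v • x) : u = v := by
  apply Subtype.ext
  apply Equiv.weightHom_injective P
  exact LinearEquiv.ext h

theorem ofIdx_smul_eq (i : ι) (x : V) :
    weylGroup.ofIdx P i • x = x - P.coroot' i x • P.root i := by
  change P.reflection i x = _
  rw [reflection_apply]

theorem weylGroup_coroot' (w : P.weylGroup) (i : ι) (x : V) :
    P.coroot' (P.weylGroupToPerm w i) (w • x) = P.coroot' i x := by
  have h := Hom.weight_coweight_transpose_apply P P (P.coroot (P.weylGroupToPerm w i)) w.1.toHom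
  have h2 := Hom.coroot_coweightMap_apply P P (P.weylGroupToPerm w i) w.1.toHom
  rw [h2] at h
  have h3 : w.1.toHom.indexEquiv.symm (P.weylGroupToPerm w i) = i :=
    w.1.toHom.indexEquiv.symm_apply_apply i
  rw [h3] at h
  exact LinearMap.congr_fun h x

theorem weylGroup_pairing (w : P.weylGroup) (i j : ι) :
    P.pairing (P.weylGroupToPerm w i) (P.weylGroupToPerm w j) = P.pairing i j := by
  have := P.weylGroup_coroot' w j (P.root i)
  rw [weylGroup_apply_root] at this
  exact this

theorem weylGroup_pairingIn [P.IsCrystallographic] (w : P.weylGroup) (i j : ι) :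
    P.pairingIn ℤ (P.weylGroupToPerm w i) (P.weylGroupToPerm w j) = P.pairingIn ℤ i j := by
  apply FaithfulSMul.algebraMap_injective ℤ ℚ
  rw [algebraMap_pairingIn, algebraMap_pairingIn, weylGroup_pairing]

theorem ofIdx_mul_self (i : ι) : weylGroup.ofIdx P i * weylGroup.ofIdx P i = 1 := by
  apply weylGroup_ext
  intro x
  rw [mul_smul, one_smul]
  exact P.reflection_same i x

theorem ofIdx_inv (i : ι) : (weylGroup.ofIdx P i)⁻¹ = weylGroup.ofIdx P i :=
  inv_eq_of_mul_eq_one_left (P.ofIdx_mul_self i)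

theorem mul_ofIdx (w : P.weylGroup) (i : ι) :
    w * weylGroup.ofIdx P i = weylGroup.ofIdx P (P.weylGroupToPerm w i) * w := by
  apply weylGroup_ext
  intro x
  rw [mul_smul, mul_smul, ofIdx_smul_eq, ofIdx_smul_eq, weylGroup_coroot', smul_sub,
    smul_comm, weylGroup_apply_root]

theorem ofIdx_reflectionPerm_self (i : ι) :
    weylGroup.ofIdx P (P.reflectionPerm i i) = weylGroup.ofIdx P i := by
  have h := P.mul_ofIdx (weylGroup.ofIdx P i) i
  rw [weylGroupToPerm_ofIdx] at h
  exact (mul_right_cancel h).symm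

theorem weylGroupToPerm_mul (u v : P.weylGroup) (i : ι) :
    P.weylGroupToPerm (u * v) i = P.weylGroupToPerm u (P.weylGroupToPerm v i) := by
  rw [map_mul]; rfl

theorem weylGroupToPerm_apply_inv (u : P.weylGroup) (i : ι) :
    P.weylGroupToPerm u (P.weylGroupToPerm u⁻¹ i) = i := by
  rw [← weylGroupToPerm_mul, mul_inv_cancel, map_one]; rfl

theorem weylGroupToPerm_reflectionPerm (w : P.weylGroup) (i j : ι) :
    P.weylGroupToPerm w (P.reflectionPerm i j) =
      P.reflectionPerm (P.weylGroupToPerm w i) (P.weylGroupToPerm w j) := by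
  have h := congrArg (fun u => P.weylGroupToPerm u j) (P.mul_ofIdx w i)
  simpa only [weylGroupToPerm_mul, weylGroupToPerm_ofIdx] using h

end Perm

namespace Base

variable {ι V V' : Type*} [AddCommGroup V] [Module ℚ V] [AddCommGroup V'] [Module ℚ V']
variable {P : RootPairing ι ℚ V V'} (b : P.Base)

theorem height_reflectionPerm [P.IsCrystallographic] (i j : ι) :
    b.height (P.reflectionPerm i j) = b.height j - P.pairingIn ℤ j i * b.height i := by
  have : P.root (P.reflectionPerm i j) = P.root j + (-P.pairingIn ℤ j i) • P.root i := by
    rw [root_reflectionPerm, neg_smul, reflection_apply_root' ℤ, sub_eq_add_neg]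
  rw [b.height_add_zsmul this, neg_smul, smul_eq_mul, sub_eq_add_neg]

theorem height_neg (i : ι) : b.height (P.reflectionPerm i i) = - b.height i :=
  b.height_reflectionPerm_self i

theorem isPos_neg_iff (i : ι) : b.IsPos (P.reflectionPerm i i) ↔ ¬ b.IsPos i :=
  IsPos.neg_iff_not b i

theorem height_perm_neg (w : P.weylGroup) (i : ι) :
    b.height (P.weylGroupToPerm w (P.reflectionPerm i i)) = - b.height (P.weylGroupToPerm w i) := by
  rw [weylGroupToPerm_reflectionPerm, height_neg]

theorem not_isPos_iff (i : ι) : ¬ b.IsPos i ↔ b.height i < 0 := by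
  have := b.height_ne_zero i
  rw [isPos_iff]; omega

theorem pairingIn_ofIdx_left [P.IsCrystallographic] (i j : ι) :
    P.pairingIn ℤ (P.reflectionPerm j i) j = - P.pairingIn ℤ i j := by
  rw [← P.pairingIn_reflectionPerm ℤ, pairingIn_reflectionPerm_self_right]

section Words

variable [Finite ι] [P.IsCrystallographic] [P.IsReduced]

/-- The simple reflections generate the Weyl group. -/
theorem exists_word (w : P.weylGroup) :
    ∃ l : List ι, (∀ i ∈ l, i ∈ b.support) ∧ w = (l.map (weylGroup.ofIdx P)).prod := by
  have key : ∀ i, ∃ l : List ι, (∀ i ∈ l, i ∈ b.support) ∧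
      weylGroup.ofIdx P i = (l.map (weylGroup.ofIdx P)).prod := by
    intro i
    induction i using b.induction_reflect with
    | h₀ i h => rwa [ofIdx_reflectionPerm_self]
    | h₁ i hi => exact ⟨[i], by simpa using hi, by simp⟩
    | h₂ i j h hj =>
      obtain ⟨l, hl, h⟩ := h
      refine ⟨j :: (l ++ [j]), ?_, ?_⟩
      · intro k hk
        simp only [List.mem_cons, List.mem_append, List.not_mem_nil, or_false] at hk
        rcases hk with rfl | hk | rfl
        exacts [hj, hl _ hk, hj]
      · have := P.mul_ofIdx (weylGroup.ofIdx P j) i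
        rw [weylGroupToPerm_ofIdx] at this
        rw [List.map_cons, List.prod_cons, List.map_append, List.prod_append, ← h,
          List.map_singleton, List.prod_singleton, ← mul_assoc, this, mul_assoc, ofIdx_mul_self,
          mul_one]
  obtain ⟨w, hw⟩ := w
  induction hw using weylGroup.induction with
  | mem i => exact key i
  | one => exact ⟨[], by simp, rfl⟩
  | mul x y hx hy ihx ihy =>
    obtain ⟨l, hl, h⟩ := ihx
    obtain ⟨m, hm, h'⟩ := ihy
    refine ⟨l ++ m, ?_, ?_⟩
    · intro k hk
      rcases List.mem_append.1 hk with hk | hk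
      exacts [hl _ hk, hm _ hk]
    · rw [List.map_append, List.prod_append, ← h, ← h']; rfl

/-- Apply the letters to `α_i` from the right. Where the root first turns negative, at a letter `j`,
it must equal `α_j`, since `s_j` permutes the other positive roots. Moving `s_i` leftwards to that
place turns it into `s_j`, which cancels the letter. -/
theorem exchange_word {i : ι} (hi : i ∈ b.support) (l : List ι) (hl : ∀ i ∈ l, i ∈ b.support)
    (h : ¬ b.IsPos (P.weylGroupToPerm (l.map (weylGroup.ofIdx P)).prod i)) :
    ∃ l' : List ι, (∀ i ∈ l', i ∈ b.support) ∧ l'.length + 1 = l.length ∧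
      (l.map (weylGroup.ofIdx P)).prod * weylGroup.ofIdx P i =
        (l'.map (weylGroup.ofIdx P)).prod := by
  induction l with
  | nil =>
    exact absurd (isPos_of_mem_support hi) (by simpa using h)
  | cons j l ih =>
    have hj : j ∈ b.support := hl j (by simp)
    have hl' : ∀ i ∈ l, i ∈ b.support := fun k hk => hl k (by simp [hk])
    by_cases h' : b.IsPos (P.weylGroupToPerm (l.map (weylGroup.ofIdx P)).prod i)
    · refine ⟨l, hl', rfl, ?_⟩
      have hij : P.weylGroupToPerm (l.map (weylGroup.ofIdx P)).prod i = j := by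
        by_contra hne
        apply h
        rw [List.map_cons, List.prod_cons, weylGroupToPerm_mul]
        exact h'.reflectionPerm hj hne
      rw [List.map_cons, List.prod_cons, mul_assoc, mul_ofIdx, hij, ← mul_assoc, ofIdx_mul_self,
        one_mul]
    · obtain ⟨l', h1, h2, h3⟩ := ih hl' h'
      refine ⟨j :: l', ?_, by simp [h2], ?_⟩
      · intro k hk
        rcases List.mem_cons.1 hk with rfl | hk
        exacts [hj, h1 _ hk]
      · rw [List.map_cons, List.prod_cons, mul_assoc, h3, List.map_cons, List.prod_cons]

theorem exists_simple_neg {w : P.weylGroup} (hw : w ≠ 1) :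
    ∃ i ∈ b.support, ¬ b.IsPos (P.weylGroupToPerm w i) := by
  classical
  have hex : ∃ n : ℕ, ∃ l : List ι, (∀ i ∈ l, i ∈ b.support) ∧ l.length = n ∧
      w = (l.map (weylGroup.ofIdx P)).prod := by
    obtain ⟨l, h1, h2⟩ := b.exists_word w
    exact ⟨_, l, h1, rfl, h2⟩
  obtain ⟨l, hl, hn, hwl⟩ := Nat.find_spec hex
  rcases List.eq_nil_or_concat l with rfl | ⟨l, i, rfl⟩
  · simp at hwl; exact absurd hwl hw
  · rw [List.concat_eq_append] at *
    have hi : i ∈ b.support := hl i (by simp)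
    have hl' : ∀ i ∈ l, i ∈ b.support := fun k hk => hl k (by simp [hk])
    -- The last letter of a shortest word works: otherwise the preceding letters make `α_i`
    -- negative, and the exchange property yields a shorter word for `w`.
    refine ⟨i, hi, fun hpos => ?_⟩
    rw [List.map_append, List.prod_append, List.map_singleton, List.prod_singleton] at hwl
    have hneg : ¬ b.IsPos (P.weylGroupToPerm (l.map (weylGroup.ofIdx P)).prod i) := by
      rw [hwl, weylGroupToPerm_mul, weylGroupToPerm_ofIdx] at hpos
      rw [not_isPos_iff]
      have := b.height_perm_neg (l.map (weylGroup.ofIdx P)).prod i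
      rw [isPos_iff] at hpos
      omega
    obtain ⟨l', h1, h2, h3⟩ := b.exchange_word hi l hl' hneg
    have hlt : l'.length < Nat.find hex := by
      rw [← hn, List.length_append]; omega
    exact Nat.find_min hex hlt ⟨l', h1, rfl, hwl.trans h3⟩

theorem finite_weylGroup (b : P.Base) : Finite P.weylGroup := by
  refine Finite.of_injective P.weylGroupToPerm
    ((injective_iff_map_eq_one P.weylGroupToPerm).2 fun w hw => ?_)
  by_contra hne
  obtain ⟨i, hi, h⟩ := b.exists_simple_neg hne
  rw [hw] at h
  exact h (isPos_of_mem_support hi)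

end Words

section Length

variable [Finite ι]

theorem length_le_add (u v : P.weylGroup) : b.length (u * v) ≤ b.length u + b.length v := by
  have hsub : {i : ι | b.IsPos i ∧ ¬ b.IsPos (P.weylGroupToPerm (u * v) i)} ⊆
      (P.weylGroupToPerm v) ⁻¹' {i : ι | b.IsPos i ∧ ¬ b.IsPos (P.weylGroupToPerm u i)} ∪
        {i : ι | b.IsPos i ∧ ¬ b.IsPos (P.weylGroupToPerm v i)} := by
    rintro i ⟨h1, h2⟩
    rw [weylGroupToPerm_mul] at h2
    by_cases h : b.IsPos (P.weylGroupToPerm v i)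
    · exact Or.inl ⟨h, h2⟩
    · exact Or.inr ⟨h1, h⟩
  refine (Set.ncard_le_ncard hsub).trans ((Set.ncard_union_le _ _).trans ?_)
  rw [Set.ncard_preimage_of_injective_subset_range (P.weylGroupToPerm v).injective
    (by simp)]
  rfl

end Length

section Rho

variable [Fintype ι] [P.IsCrystallographic] [P.IsReduced]

open Classical in
/-- The set of positive roots. -/
def posRoots : Finset ι := Finset.univ.filter b.IsPos

@[simp] theorem mem_posRoots {i : ι} : i ∈ b.posRoots ↔ b.IsPos i := by
  simp [posRoots]

/-- `s_j` permutes the positive roots other than `α_j` and changes the sign of the pairing with the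
coroot, so only the term of `α_j` itself survives. -/
theorem sum_pairingIn_simple {j : ι} (hj : j ∈ b.support) :
    ∑ i ∈ b.posRoots, P.pairingIn ℤ i j = 2 := by
  classical
  have hjp : j ∈ b.posRoots := b.mem_posRoots.2 (isPos_of_mem_support hj)
  rw [← Finset.add_sum_erase _ _ hjp, pairingIn_same, add_eq_left]
  refine Finset.sum_involution (fun i _ => P.reflectionPerm j i) ?_ ?_ ?_ ?_
  · intro i _
    rw [pairingIn_ofIdx_left]; ring
  · intro i _ h he
    have := pairingIn_ofIdx_left (P := P) i j
    rw [he] at this; omega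
  · intro i hi
    rw [Finset.mem_erase, mem_posRoots] at hi ⊢
    refine ⟨fun he => ?_, hi.2.reflectionPerm hj hi.1⟩
    have h2 : i = P.reflectionPerm j j := by
      have h := congrArg (P.reflectionPerm j) he
      rwa [reflectionPerm_self] at h
    have := hi.2
    rw [h2, isPos_neg_iff] at this
    exact this (isPos_of_mem_support hj)
  · intro i _
    rw [reflectionPerm_self]

/-- `⟨α^∨, 2ρ⟩` is the sum of the `⟨α^∨, β⟩` over the positive roots `β`. -/
theorem sum_pairingIn_eq (j : ι) :
    ∑ i ∈ b.posRoots, P.pairingIn ℤ i j = 2 * b.corootRho j := by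
  obtain ⟨f, -, -, hf⟩ := b.flip.exists_root_eq_sum_int j
  have h : b.corootRho j = ∑ k ∈ b.support, f k := height_eq_sum (b := b.flip) hf
  have hf' : P.coroot j = ∑ k ∈ b.support, f k • P.coroot k := hf
  have key : ∀ i, P.pairingIn ℤ i j = ∑ k ∈ b.support, f k * P.pairingIn ℤ i k := by
    intro i
    apply FaithfulSMul.algebraMap_injective ℤ ℚ
    simp only [map_sum, map_mul, algebraMap_pairingIn]
    simp only [← root_coroot_eq_pairing, hf', map_sum, map_zsmul, zsmul_eq_mul, eq_intCast]
  rw [h, Finset.sum_congr rfl fun i _ => key i, Finset.sum_comm, Finset.mul_sum]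
  refine Finset.sum_congr rfl fun k hk => ?_
  rw [← Finset.mul_sum, b.sum_pairingIn_simple hk, mul_comm]

theorem pairingIn_pos_of_reflection_neg {i j : ι} (hj : b.IsPos j) (hi : b.IsPos i)
    (h : ¬ b.IsPos (P.reflectionPerm j i)) : 0 < P.pairingIn ℤ i j := by
  rw [not_isPos_iff, height_reflectionPerm] at h
  rw [isPos_iff] at hi hj
  by_contra hle
  nlinarith

/-- In `⟨α^∨, 2ρ⟩` the positive roots that stay positive under `s_α` cancel in pairs. Each inverted
root contributes at least 1, and `α` contributes 2, whence the extra 1. -/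
theorem length_ofIdx_lt {j : ι} (hj : b.IsPos j) :
    (b.length (weylGroup.ofIdx P j) : ℤ) + 1 ≤ 2 * b.corootRho j := by
  classical
  have hset : {i : ι | b.IsPos i ∧ ¬ b.IsPos (P.weylGroupToPerm (weylGroup.ofIdx P j) i)} =
      ↑(b.posRoots.filter fun i => ¬ b.IsPos (P.reflectionPerm j i)) := by
    ext i
    simp only [Set.mem_ofPred_eq, Finset.coe_filter, mem_posRoots, weylGroupToPerm_ofIdx]
  rw [length, hset, Set.ncard_coe_finset, ← sum_pairingIn_eq,
    ← Finset.sum_filter_add_sum_filter_not b.posRoots fun i => ¬ b.IsPos (P.reflectionPerm j i)]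
  have hz : ∑ i ∈ b.posRoots.filter (fun i => ¬ ¬ b.IsPos (P.reflectionPerm j i)),
      P.pairingIn ℤ i j = 0 := by
    refine Finset.sum_involution (fun i _ => P.reflectionPerm j i) ?_ ?_ ?_ ?_
    · intro i _
      rw [pairingIn_ofIdx_left]; ring
    · intro i _ h he
      have := pairingIn_ofIdx_left (P := P) i j
      rw [he] at this; omega
    · intro i hi
      simp only [Finset.mem_filter, mem_posRoots, not_not, reflectionPerm_self] at hi ⊢
      exact ⟨hi.2, hi.1⟩
    · intro i _
      rw [reflectionPerm_self]
  have hjm : j ∈ b.posRoots.filter fun i => ¬ b.IsPos (P.reflectionPerm j i) := by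
    simp [hj, isPos_neg_iff]
  rw [hz, add_zero, ← Finset.add_sum_erase _ _ hjm, ← Finset.card_erase_add_one hjm,
    pairingIn_same]
  have : ((b.posRoots.filter fun i => ¬ b.IsPos (P.reflectionPerm j i)).erase j).card • (1 : ℤ) ≤
      ∑ i ∈ (b.posRoots.filter fun i => ¬ b.IsPos (P.reflectionPerm j i)).erase j,
        P.pairingIn ℤ i j := by
    refine Finset.card_nsmul_le_sum _ _ _ fun i hi => ?_
    simp only [Finset.mem_erase, Finset.mem_filter, mem_posRoots] at hi
    exact b.pairingIn_pos_of_reflection_neg hj hi.2.1 hi.2.2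
  rw [nsmul_eq_mul, mul_one] at this
  push_cast
  linarith

theorem corootRho_pos {j : ι} (hj : b.IsPos j) : 0 < b.corootRho j := by
  have := b.length_ofIdx_lt hj
  omega

/-- A downward edge is therefore a largest possible drop in length; this later limits the weight of
one step to a single coroot. -/
theorem length_le_length_mul_ofIdx (w : P.weylGroup) {j : ι} (hj : b.IsPos j) :
    (b.length w : ℤ) + 1 ≤ b.length (w * weylGroup.ofIdx P j) + 2 * b.corootRho j := by
  have h1 := b.length_le_add (w * weylGroup.ofIdx P j) (weylGroup.ofIdx P j)
  rw [mul_assoc, ofIdx_mul_self, mul_one] at h1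
  have h2 := b.length_ofIdx_lt hj
  omega

end Rho

end Base
end RootPairing
end

/-! ### The extended affine Weyl group acting on affine roots, and its length function. -/

noncomputable section
open RootPairing
set_option linter.unusedSectionVars false

namespace CocharacterDatum

variable {ι V V' X : Type*} [AddCommGroup V] [Module ℚ V] [AddCommGroup V'] [Module ℚ V']
variable {P : RootPairing ι ℚ V V'} [P.IsCrystallographic]
variable [AddCommGroup X] [DistribMulAction P.weylGroup X]
variable (D : CocharacterDatum P X) (b : P.Base)

section Action

theorem smul_zsmul_eq (w : P.weylGroup) (k : ℤ) (x : X) : w • (k • x) = k • (w • x) :=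
  map_zsmul (DistribSMul.toAddMonoidHom X w) k x

theorem t_mul_t (x y : X) : D.t x * D.t y = D.t (x + y) := by
  rw [t, t, t, ← map_mul]; rfl

theorem fin_mul_fin (u v : P.weylGroup) : D.fin u * D.fin v = D.fin (u * v) := by
  rw [fin, fin, fin, ← map_mul]

theorem fin_one : D.fin 1 = 1 := map_one _

theorem fin_mul_t (w : P.weylGroup) (x : X) : D.fin w * D.t x = D.t (w • x) * D.fin w := by
  refine SemidirectProduct.ext ?_ ?_
  · simp only [fin, t, SemidirectProduct.mul_left, SemidirectProduct.left_inr,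
      SemidirectProduct.left_inl, SemidirectProduct.right_inr, SemidirectProduct.right_inl,
      one_mul, map_one, mul_one]
    rfl
  · simp [fin, t]

theorem t_mul_fin_inj {x y : X} {u v : P.weylGroup} (h : D.t x * D.fin u = D.t y * D.fin v) :
    x = y ∧ u = v := by
  constructor
  · have := congrArg SemidirectProduct.left h
    simpa [t, fin] using this
  · have := congrArg SemidirectProduct.right h
    simpa [t, fin] using this

theorem exists_eq_t_mul_fin (u : D.ExtWeyl) : ∃ x w, u = D.t x * D.fin w :=
  ⟨u.left.toAdd, u.right, (SemidirectProduct.inl_left_mul_inr_right u).symm⟩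

theorem root_smul_right (w : P.weylGroup) (i : ι) (x : X) :
    D.root i (w • x) = D.root (P.weylGroupToPerm w⁻¹ i) x := by
  have := D.root_smul w (P.weylGroupToPerm w⁻¹ i) x
  rwa [weylGroupToPerm_apply_inv] at this

theorem root_reflectionPerm (i j : ι) (x : X) :
    D.root (P.reflectionPerm i j) x = D.root j x - P.pairingIn ℤ j i * D.root i x := by
  have h := D.root_smul_right (weylGroup.ofIdx P i) j x
  rw [ofIdx_inv, weylGroupToPerm_ofIdx, D.reflection_smul, map_sub, map_zsmul, D.root_coroot,
    smul_eq_mul, mul_comm] at h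
  exact h.symm

theorem root_neg (i : ι) (x : X) : D.root (P.reflectionPerm i i) x = - D.root i x := by
  rw [root_reflectionPerm, pairingIn_same]; ring

theorem coroot_reflectionPerm (i j : ι) :
    D.coroot (P.reflectionPerm i j) = D.coroot j - P.pairingIn ℤ i j • D.coroot i := by
  rw [← D.root_coroot, ← D.reflection_smul, D.smul_coroot, weylGroupToPerm_ofIdx]

theorem coroot_neg (i : ι) : D.coroot (P.reflectionPerm i i) = - D.coroot i := by
  rw [coroot_reflectionPerm, pairingIn_same, two_smul]; abel

theorem actAffine_t_mul_fin (x : X) (w : P.weylGroup) (a : ι × ℤ) :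
    D.actAffine (D.t x * D.fin w) a =
      (P.weylGroupToPerm w a.1, a.2 - D.root (P.weylGroupToPerm w a.1) x) := by
  simp [actAffine, t, fin]

theorem actAffine_mul (u v : D.ExtWeyl) (a : ι × ℤ) :
    D.actAffine (u * v) a = D.actAffine u (D.actAffine v a) := by
  obtain ⟨x, w, rfl⟩ := D.exists_eq_t_mul_fin u
  obtain ⟨y, z, rfl⟩ := D.exists_eq_t_mul_fin v
  have h : D.t x * D.fin w * (D.t y * D.fin z) = D.t (x + w • y) * D.fin (w * z) := by
    rw [mul_assoc, ← mul_assoc (D.fin w), fin_mul_t, mul_assoc, fin_mul_fin, ← mul_assoc, t_mul_t]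
  simp only [h, actAffine_t_mul_fin, weylGroupToPerm_mul, map_add, D.root_smul]
  exact Prod.ext rfl (by simp only; ring)

theorem actAffine_one (a : ι × ℤ) : D.actAffine 1 a = a := by
  have := D.actAffine_t_mul_fin 0 1 a
  rw [fin_one, mul_one] at this
  have h0 : D.t 0 = 1 := map_one _
  rw [h0, map_one, map_zero] at this
  simpa using this

theorem actAffine_inv_apply (u : D.ExtWeyl) (a : ι × ℤ) :
    D.actAffine u⁻¹ (D.actAffine u a) = a := by
  rw [← actAffine_mul, inv_mul_cancel, actAffine_one]

theorem actAffine_injective (u : D.ExtWeyl) : Function.Injective (D.actAffine u) :=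
  Function.LeftInverse.injective (D.actAffine_inv_apply u)

theorem actAffine_surjective (u : D.ExtWeyl) : Function.Surjective (D.actAffine u) := fun a =>
  ⟨D.actAffine u⁻¹ a, by rw [← actAffine_mul, mul_inv_cancel, actAffine_one]⟩

/-- The reflection in the affine root `a`. -/
def refl (a : ι × ℤ) : D.ExtWeyl := D.affineReflection a.1 (-a.2)

/-- The opposite of an affine root. -/
def negAffine (P : RootPairing ι ℚ V V') (a : ι × ℤ) : ι × ℤ := (P.reflectionPerm a.1 a.1, -a.2)

theorem refl_eq (a : ι × ℤ) :
    D.refl a = D.t (-a.2 • D.coroot a.1) * D.fin (weylGroup.ofIdx P a.1) := rfl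

theorem refl_negAffine (a : ι × ℤ) : D.refl (negAffine P a) = D.refl a := by
  rw [refl_eq, refl_eq, negAffine, ofIdx_reflectionPerm_self, coroot_neg, smul_neg]
  simp

theorem actAffine_refl (a c : ι × ℤ) :
    D.actAffine (D.refl a) c =
      (P.reflectionPerm a.1 c.1, c.2 - P.pairingIn ℤ c.1 a.1 * a.2) := by
  rw [refl_eq, actAffine_t_mul_fin, weylGroupToPerm_ofIdx, map_zsmul, D.root_coroot,
    RootPairing.Base.pairingIn_ofIdx_left]
  exact Prod.ext rfl (by simp [mul_comm])

theorem refl_mul_self (a : ι × ℤ) : D.refl a * D.refl a = 1 := by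
  rw [refl_eq, mul_assoc, ← mul_assoc (D.fin _), fin_mul_t, mul_assoc, fin_mul_fin,
    ofIdx_mul_self, fin_one, mul_one, t_mul_t, D.reflection_smul, map_zsmul, D.root_coroot,
    pairingIn_same]
  have : (-a.2 • D.coroot a.1 + (-a.2 • D.coroot a.1 - (-a.2 • (2 : ℤ)) • D.coroot a.1)) = 0 := by
    simp only [smul_eq_mul]; module
  rw [this]; rfl

theorem mul_refl_mul_refl (u : D.ExtWeyl) (a : ι × ℤ) : u * D.refl a * D.refl a = u := by
  rw [mul_assoc, refl_mul_self, mul_one]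

theorem mul_refl (u : D.ExtWeyl) (a : ι × ℤ) :
    u * D.refl a = D.refl (D.actAffine u a) * u := by
  obtain ⟨x, w, rfl⟩ := D.exists_eq_t_mul_fin u
  rw [actAffine_t_mul_fin, refl_eq, refl_eq]
  simp only
  have h1 : D.t x * D.fin w * (D.t (-a.2 • D.coroot a.1) * D.fin (weylGroup.ofIdx P a.1)) =
      D.t (x + -a.2 • D.coroot (P.weylGroupToPerm w a.1)) *
        D.fin (w * weylGroup.ofIdx P a.1) := by
    rw [mul_assoc, ← mul_assoc (D.fin w), fin_mul_t, mul_assoc, fin_mul_fin, ← mul_assoc, t_mul_t,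
      smul_zsmul_eq, D.smul_coroot]
  rw [h1, mul_assoc (D.t _), ← mul_assoc (D.fin _), fin_mul_t, mul_assoc, fin_mul_fin, ← mul_assoc,
    t_mul_t, mul_ofIdx, D.reflection_smul]
  congr 2
  module

theorem refl_conj (c a : ι × ℤ) :
    D.refl c * D.refl a * D.refl c = D.refl (D.actAffine (D.refl c) a) := by
  rw [D.mul_refl (D.refl c), mul_refl_mul_refl]

theorem mul_refl_comm (u : D.ExtWeyl) (c a : ι × ℤ) :
    u * D.refl a * D.refl c = u * D.refl c * D.refl (D.actAffine (D.refl c) a) := by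
  rw [← refl_conj, mul_assoc u (D.refl c), mul_assoc (D.refl c), ← mul_assoc (D.refl c) (D.refl c),
    refl_mul_self, one_mul, mul_assoc]

theorem pairingIn_actAffine (u : D.ExtWeyl) (a c : ι × ℤ) :
    P.pairingIn ℤ (D.actAffine u a).1 (D.actAffine u c).1 = P.pairingIn ℤ a.1 c.1 :=
  weylGroup_pairingIn P u.right a.1 c.1

theorem actAffine_negAffine (u : D.ExtWeyl) (a : ι × ℤ) :
    D.actAffine u (negAffine P a) = negAffine P (D.actAffine u a) := by
  obtain ⟨x, w, rfl⟩ := D.exists_eq_t_mul_fin u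
  simp only [actAffine_t_mul_fin, negAffine, weylGroupToPerm_reflectionPerm, root_neg]
  exact Prod.ext rfl (by simp only; ring)

end Action

section Height

variable [Fintype ι]

/-- A bound for the heights of the roots. -/
def levelBound (b : P.Base) : ℤ := 1 + ∑ i, |b.height i|

theorem abs_height_lt (i : ι) : |b.height i| < levelBound b := by
  have := Finset.single_le_sum (f := fun i => |b.height i|) (fun i _ => abs_nonneg _)
    (Finset.mem_univ i)
  rw [levelBound]; linarith

/-- An additive function on affine roots, positive exactly on the positive affine roots. -/
def affHeight (a : ι × ℤ) : ℤ := b.height a.1 + levelBound b * a.2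

/-- Up to the factor `N = levelBound b`, `affHeight` evaluates an affine root at the point `ρ^∨/N`
of the base alcove. As all heights are below `N` in absolute value, the sign is that of `k`, or of
the height when `k = 0`. -/
theorem isPosAffine_iff (a : ι × ℤ) : IsPosAffine b a ↔ 0 < affHeight b a := by
  have h := abs_lt.1 (abs_height_lt b a.1)
  have h0 := b.height_ne_zero a.1
  rw [IsPosAffine, affHeight, Base.isPos_iff]
  constructor
  · rintro (⟨h1, h2⟩ | ⟨h1, h2⟩)
    · have : 0 ≤ levelBound b * a.2 := mul_nonneg (by omega) h2
      omega
    · have : levelBound b * 1 ≤ levelBound b * a.2 :=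
        mul_le_mul_of_nonneg_left h2 (by omega)
      omega
  · intro h3
    by_contra hc
    push Not at hc
    by_cases hp : 0 < b.height a.1
    · have h4 : a.2 ≤ -1 := by have := hc.1 hp; omega
      have : levelBound b * a.2 ≤ levelBound b * (-1) :=
        mul_le_mul_of_nonneg_left h4 (by omega)
      omega
    · have h4 : a.2 ≤ 0 := by have := hc.2 (by omega); omega
      have : levelBound b * a.2 ≤ levelBound b * 0 :=
        mul_le_mul_of_nonneg_left h4 (by omega)
      omega

theorem affHeight_negAffine (a : ι × ℤ) : affHeight b (negAffine P a) = - affHeight b a := by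
  simp only [affHeight, negAffine, Base.height_neg]; ring

theorem affHeight_ne_zero (a : ι × ℤ) : affHeight b a ≠ 0 := by
  have h := abs_lt.1 (abs_height_lt b a.1)
  have h0 := b.height_ne_zero a.1
  rw [affHeight]
  intro h1
  rcases lt_trichotomy a.2 0 with h2 | h2 | h2
  · nlinarith
  · rw [h2, mul_zero, add_zero] at h1; exact h0 h1
  · nlinarith

/-- Affine roots are encoded as pairs and have no addition of their own. Sums such as `c - ⟨c, a^∨⟩
a` are handled through this identity for their values. -/
theorem affHeight_refl (a c : ι × ℤ) :
    affHeight b (D.actAffine (D.refl a) c) =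
      affHeight b c - P.pairingIn ℤ c.1 a.1 * affHeight b a := by
  rw [actAffine_refl]
  simp only [affHeight, Base.height_reflectionPerm]; ring

theorem affHeight_mul_refl (u : D.ExtWeyl) (a c : ι × ℤ) :
    affHeight b (D.actAffine (u * D.refl a) c) =
      affHeight b (D.actAffine u c) - P.pairingIn ℤ c.1 a.1 * affHeight b (D.actAffine u a) := by
  rw [mul_refl, actAffine_mul, affHeight_refl, pairingIn_actAffine]

theorem affHeight_mul_refl_self (u : D.ExtWeyl) (a : ι × ℤ) :
    affHeight b (D.actAffine (u * D.refl a) a) = - affHeight b (D.actAffine u a) := by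
  rw [affHeight_mul_refl, pairingIn_same]; ring

/-- The set of positive affine roots made negative by `u`. -/
def inv (u : D.ExtWeyl) : Set (ι × ℤ) :=
  {a | 0 < affHeight b a ∧ affHeight b (D.actAffine u a) < 0}

theorem length_eq (u : D.ExtWeyl) : D.length b u = (D.inv b u).ncard := by
  rw [length, inv]
  congr 1
  ext a
  have := affHeight_ne_zero b (D.actAffine u a)
  simp only [Set.mem_ofPred_eq, isPosAffine_iff]
  constructor <;> rintro ⟨h1, h2⟩ <;> exact ⟨h1, by omega⟩

theorem finite_inv (u : D.ExtWeyl) : (D.inv b u).Finite := by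
  have hf : (⋃ i : ι, (fun k => (i, k)) '' Set.Icc (0 : ℤ)
      (1 + |D.root (P.weylGroupToPerm u.right i) u.left.toAdd|)).Finite :=
    Set.finite_iUnion fun i => (Set.finite_Icc _ _).image _
  refine hf.subset ?_
  rintro ⟨i, k⟩ ⟨h1, h2⟩
  have h3 : ¬ IsPosAffine b (D.actAffine u (i, k)) := by rw [isPosAffine_iff]; omega
  rw [← isPosAffine_iff] at h1
  simp only [Set.mem_iUnion, Set.mem_image, Set.mem_Icc, Prod.mk.injEq]
  refine ⟨i, k, ⟨?_, ?_⟩, rfl, rfl⟩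
  · rcases h1 with ⟨-, h1⟩ | ⟨-, h1⟩ <;> simp only at h1 <;> omega
  · simp only [IsPosAffine, actAffine] at h3
    have := le_abs_self (D.root (P.weylGroupToPerm u.right i) u.left.toAdd)
    by_contra hlt
    apply h3
    by_cases hp : b.IsPos (P.weylGroupToPerm u.right i)
    · left; exact ⟨hp, by omega⟩
    · right; exact ⟨hp, by omega⟩

theorem length_mul_le (u v : D.ExtWeyl) :
    D.length b (u * v) ≤ D.length b u + D.length b v := by
  have hsub : D.inv b (u * v) ⊆ D.actAffine v ⁻¹' D.inv b u ∪ D.inv b v := by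
    rintro a ⟨h1, h2⟩
    rw [actAffine_mul] at h2
    have := affHeight_ne_zero b (D.actAffine v a)
    by_cases h : 0 < affHeight b (D.actAffine v a)
    · exact Or.inl ⟨h, h2⟩
    · exact Or.inr ⟨h1, by omega⟩
  have hfin := (D.finite_inv b u).preimage (D.actAffine_injective v).injOn
  rw [length_eq, length_eq, length_eq]
  refine (Set.ncard_le_ncard hsub (hfin.union (D.finite_inv b v))).trans
    ((Set.ncard_union_le _ _).trans ?_)
  rw [Set.ncard_preimage_of_injective_subset_range (D.actAffine_injective v)
    (by simp [(D.actAffine_surjective v).range_eq])]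

/-- Multiplication by a reflection whose root stays positive increases the length. -/
theorem length_lt_mul_refl {u : D.ExtWeyl} {a : ι × ℤ} (ha : 0 < affHeight b a)
    (hu : 0 < affHeight b (D.actAffine u a)) : D.length b u < D.length b (u * D.refl a) := by
  classical
  rw [length_eq, length_eq]
  -- An injection from the inversions of `u` to those of `u r` other than `a`: reflect an inversion
  -- when the result is positive, and otherwise leave it alone.
  set φ : ι × ℤ → ι × ℤ := fun c =>
    if 0 < affHeight b (D.actAffine (D.refl a) c) then D.actAffine (D.refl a) c else c with hφ
  have hinvol : ∀ c, D.actAffine (D.refl a) (D.actAffine (D.refl a) c) = c := fun c => by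
    rw [← actAffine_mul, refl_mul_self, actAffine_one]
  have hmaps : ∀ c ∈ D.inv b u, φ c ∈ D.inv b (u * D.refl a) \ {a} := by
    rintro c ⟨h1, h2⟩
    have h3 := D.affHeight_refl b a c
    by_cases h : 0 < affHeight b (D.actAffine (D.refl a) c)
    · have e : φ c = D.actAffine (D.refl a) c := if_pos h
      rw [e]
      refine ⟨⟨h, ?_⟩, ?_⟩
      · rw [actAffine_mul, hinvol]; exact h2
      · intro (h4 : _ = a)
        have h5 : c = D.actAffine (D.refl a) a := by rw [← hinvol c, h4]
        have h6 := D.affHeight_refl b a a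
        rw [← h5, pairingIn_same] at h6
        omega
    · have e : φ c = c := if_neg h
      rw [e]
      have hm : 0 < P.pairingIn ℤ c.1 a.1 := by
        by_contra hle; nlinarith
      refine ⟨⟨h1, ?_⟩, ?_⟩
      · rw [affHeight_mul_refl]; nlinarith
      · rintro (rfl : c = a)
        omega
  have hinj : Set.InjOn φ (D.inv b u) := by
    rintro c ⟨h1, -⟩ d ⟨h2, -⟩ he
    simp only [hφ] at he
    split_ifs at he with h3 h4 h4
    · exact D.actAffine_injective _ he
    · rw [← he, hinvol] at h4; omega
    · rw [he, hinvol] at h3; omega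
    · exact he
  have hamem : a ∈ D.inv b (u * D.refl a) :=
    ⟨ha, by rw [affHeight_mul_refl_self]; omega⟩
  have hfin := D.finite_inv b (u * D.refl a)
  have h1 := Set.ncard_le_ncard_of_injOn φ hmaps hinj (hfin.subset Set.sdiff_subset)
  have h2 := Set.ncard_sdiff_singleton_lt_of_mem hamem hfin
  omega

theorem length_mul_refl_lt {u : D.ExtWeyl} {a : ι × ℤ} (ha : 0 < affHeight b a)
    (hu : affHeight b (D.actAffine u a) < 0) : D.length b (u * D.refl a) < D.length b u := by
  have := D.length_lt_mul_refl b (u := u * D.refl a) ha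
    (by rw [affHeight_mul_refl_self]; omega)
  rwa [mul_refl_mul_refl] at this

theorem affHeight_pos_of_length_lt {u : D.ExtWeyl} {a : ι × ℤ} (ha : 0 < affHeight b a)
    (h : D.length b u < D.length b (u * D.refl a)) : 0 < affHeight b (D.actAffine u a) := by
  by_contra hc
  have := affHeight_ne_zero b (D.actAffine u a)
  have := D.length_mul_refl_lt b ha (u := u) (by omega)
  omega

theorem exists_pos_refl (a : ι × ℤ) : ∃ c, 0 < affHeight b c ∧ D.refl c = D.refl a := by
  by_cases h : 0 < affHeight b a
  · exact ⟨a, h, rfl⟩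
  · refine ⟨negAffine P a, ?_, D.refl_negAffine a⟩
    have := affHeight_ne_zero b a
    rw [affHeight_negAffine]; omega

end Height
end CocharacterDatum
end

/-! ### The chain property of the Bruhat order. -/

noncomputable section
open RootPairing
set_option linter.unusedSectionVars false

namespace CocharacterDatum

variable {ι V V' X : Type*} [AddCommGroup V] [Module ℚ V] [AddCommGroup V'] [Module ℚ V']
variable {P : RootPairing ι ℚ V V'} [P.IsCrystallographic]
variable [AddCommGroup X] [DistribMulAction P.weylGroup X]
variable (D : CocharacterDatum P X) (b : P.Base)
variable [Fintype ι]

theorem affHeight_act_refl (u : D.ExtWeyl) (a c : ι × ℤ) :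
    affHeight b (D.actAffine u (D.actAffine (D.refl a) c)) =
      affHeight b (D.actAffine u c) - P.pairingIn ℤ c.1 a.1 * affHeight b (D.actAffine u a) := by
  rw [← actAffine_mul, affHeight_mul_refl]

theorem affHeight_act_neg (u : D.ExtWeyl) (a : ι × ℤ) :
    affHeight b (D.actAffine u (negAffine P a)) = - affHeight b (D.actAffine u a) := by
  rw [actAffine_negAffine, affHeight_negAffine]

/-- An element which is not of length `0` makes negative a root whose reflection has length `1`. -/
theorem exists_simple [P.IsReduced] {v : D.ExtWeyl} (hv : D.length b v ≠ 0) :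
    ∃ c, 0 < affHeight b c ∧ affHeight b (D.actAffine v c) < 0 ∧ D.inv b (D.refl c) = {c} := by
  have hne : ∃ n : ℕ, ∃ c, 0 < affHeight b c ∧ affHeight b (D.actAffine v c) < 0 ∧
      (affHeight b c).toNat = n := by
    rw [length_eq] at hv
    obtain ⟨c, h1, h2⟩ := Set.nonempty_of_ncard_ne_zero hv
    exact ⟨_, c, h1, h2, rfl⟩
  classical
  -- Take an inversion `a` of least height. Were `a` a sum of two positive affine roots, one of them
  -- would be a lower inversion. A second inversion of `s_a` will produce such a sum or another
  -- lower inversion.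
  obtain ⟨a, ha, hva, hn⟩ := Nat.find_spec hne
  have hmin : ∀ c, 0 < affHeight b c → affHeight b c < affHeight b a →
      0 < affHeight b (D.actAffine v c) := by
    intro c h1 h2
    by_contra h3
    have := affHeight_ne_zero b (D.actAffine v c)
    exact Nat.find_min hne (m := (affHeight b c).toNat) (by omega) ⟨c, h1, by omega, rfl⟩
  -- no decomposition of `a` into two positive affine roots
  have hdec : ∀ c d, 0 < affHeight b c → 0 < affHeight b d →
      affHeight b a = affHeight b c + affHeight b d →
      affHeight b (D.actAffine v a) =
        affHeight b (D.actAffine v c) + affHeight b (D.actAffine v d) → False := by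
    intro c d h1 h2 h3 h4
    have := hmin c h1 (by omega)
    have := hmin d h2 (by omega)
    omega
  refine ⟨a, ha, hva, ?_⟩
  apply Set.eq_singleton_iff_unique_mem.2
  refine ⟨⟨ha, by rw [affHeight_refl, pairingIn_same]; linarith⟩, ?_⟩
  rintro c ⟨hc, hc2⟩
  by_contra hca
  have e1 := D.affHeight_refl b a c
  have e2 := D.affHeight_act_refl b v a c
  have f1 := D.affHeight_refl b c a
  have f2 := D.affHeight_act_refl b v c a
  have hm : 0 < P.pairingIn ℤ c.1 a.1 := by
    by_contra hle; nlinarith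
  have hset := P.pairingIn_pairingIn_mem_set_of_isCrystal_of_isRed c.1 a.1
  have hN : 0 < levelBound b := lt_of_le_of_lt (abs_nonneg _) (abs_height_lt b a.1)
  -- This is `d = m a - c` with `m = ⟨c, a^∨⟩ > 0`, a positive affine root.
  set d := negAffine P (D.actAffine (D.refl a) c) with hd
  have d1 : affHeight b d = P.pairingIn ℤ c.1 a.1 * affHeight b a - affHeight b c := by
    rw [hd, affHeight_negAffine, e1]; ring
  have d2 : affHeight b (D.actAffine v d) =
      P.pairingIn ℤ c.1 a.1 * affHeight b (D.actAffine v a) - affHeight b (D.actAffine v c) := by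
    rw [hd, affHeight_act_neg, e2]; ring
  have hdpos : 0 < affHeight b d := by rw [hd, affHeight_negAffine]; omega
  -- Parallel roots: `c` and `d = 2a - c` are opposite shifts of `a` by a constant, so the lower one
  -- is also made negative by `v`.
  by_cases h22 : P.pairingIn ℤ c.1 a.1 = 2 ∧ P.pairingIn ℤ a.1 c.1 = 2
  · have hca1 : c.1 = a.1 := (P.pairingIn_two_two_iff ℤ c.1 a.1).1 h22
    rw [h22.1] at d1 d2
    have g1 : affHeight b c = affHeight b a + levelBound b * (c.2 - a.2) := by
      rw [affHeight, affHeight, hca1]; ring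
    have g2 : affHeight b (D.actAffine v c) =
        affHeight b (D.actAffine v a) + levelBound b * (c.2 - a.2) := by
      simp only [affHeight, actAffine, hca1]; ring
    rcases lt_trichotomy c.2 a.2 with h | h | h
    · have : levelBound b * (c.2 - a.2) < 0 := mul_neg_of_pos_of_neg hN (by omega)
      have := hmin c hc (by omega)
      omega
    · exact hca (Prod.ext hca1 h)
    · have : 0 < levelBound b * (c.2 - a.2) := mul_pos hN (by omega)
      have := hmin d hdpos (by omega)
      omega
  by_cases h1 : P.pairingIn ℤ c.1 a.1 = 1
  · rw [h1] at d1 d2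
    exact hdec c d hc hdpos (by omega) (by omega)
  obtain ⟨h1', hm23⟩ : P.pairingIn ℤ a.1 c.1 = 1 ∧
      (P.pairingIn ℤ c.1 a.1 = 2 ∨ P.pairingIn ℤ c.1 a.1 = 3) := by
    simp only [Set.mem_insert_iff, Set.mem_singleton_iff, Prod.mk.injEq] at hset
    omega
  rw [h1'] at f1 f2
  by_cases he : 0 < affHeight b (D.actAffine (D.refl c) a)
  · exact hdec c _ hc he (by omega) (by omega)
  have hpd : P.pairingIn ℤ a.1 d.1 = 1 := by
    rw [← h1', hd, actAffine_refl]
    simp only [negAffine]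
    rw [pairingIn_reflectionPerm_self_right, pairingIn_reflectionPerm,
      pairingIn_reflectionPerm_self_left, neg_neg]
  have k1 := D.affHeight_refl b d a
  have k2 := D.affHeight_act_refl b v d a
  rw [hpd] at k1 k2
  by_cases hg : 0 < affHeight b (D.actAffine (D.refl d) a)
  · exact hdec d _ hdpos hg (by omega) (by omega)
  have hg0 := affHeight_ne_zero b (D.actAffine (D.refl d) a)
  have he0 := affHeight_ne_zero b (D.actAffine (D.refl c) a)
  -- Now `a - c` and `a - d` are both negative, while `c + d = m a`. This is impossible for `m = 2`;
  -- for `m = 3` it gives the decomposition `a = (c - a) + (d - a)`.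
  rcases hm23 with hm2 | hm3
  · rw [hm2] at d1; omega
  · rw [hm3] at d1 d2
    refine hdec (negAffine P (D.actAffine (D.refl c) a)) (negAffine P (D.actAffine (D.refl d) a))
      ?_ ?_ ?_ ?_
    all_goals simp only [affHeight_negAffine, affHeight_act_neg]
    all_goals omega

/-- The cover relation of the Bruhat order. -/
def Cov (u v : D.ExtWeyl) : Prop :=
  ∃ a : ι × ℤ, v = u * D.refl a ∧ D.length b v = D.length b u + 1

section Simple

variable {b} {c : ι × ℤ} (hinv : D.inv b (D.refl c) = {c})
include hinv

theorem length_simple : D.length b (D.refl c) = 1 := by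
  rw [length_eq, hinv, Set.ncard_singleton]

theorem affHeight_simple_pos : 0 < affHeight b c :=
  (hinv ▸ Set.mem_singleton c : c ∈ D.inv b (D.refl c)).1

theorem affHeight_simple_act_pos {a : ι × ℤ} (ha : 0 < affHeight b a) (hac : a ≠ c) :
    0 < affHeight b (D.actAffine (D.refl c) a) := by
  by_contra h
  have h0 := affHeight_ne_zero b (D.actAffine (D.refl c) a)
  have : a ∈ D.inv b (D.refl c) := ⟨ha, by omega⟩
  rw [hinv] at this
  exact hac this

theorem length_mul_simple_of_pos {u : D.ExtWeyl} (hu : 0 < affHeight b (D.actAffine u c)) :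
    D.length b (u * D.refl c) = D.length b u + 1 := by
  have h1 := D.length_lt_mul_refl b (D.affHeight_simple_pos hinv) hu
  have h2 := D.length_mul_le b u (D.refl c)
  rw [D.length_simple hinv] at h2
  omega

theorem length_mul_simple_of_neg {u : D.ExtWeyl} (hu : affHeight b (D.actAffine u c) < 0) :
    D.length b (u * D.refl c) + 1 = D.length b u := by
  have := D.length_mul_simple_of_pos hinv (u := u * D.refl c)
    (by rw [affHeight_mul_refl_self]; omega)
  rw [mul_refl_mul_refl] at this
  exact this.symm

/-- If `u < u r` for a reflection `r` and `u r ≠ u s` for a simple reflection `s`,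
then `u s < u r s`. -/
theorem length_simple_lt {u : D.ExtWeyl} {a : ι × ℤ}
    (h : D.length b u < D.length b (u * D.refl a)) (hne : u * D.refl a ≠ u * D.refl c) :
    ∃ a', u * D.refl a * D.refl c = u * D.refl c * D.refl a' ∧
      D.length b (u * D.refl c) < D.length b (u * D.refl a * D.refl c) := by
  obtain ⟨d, hd, hda⟩ := D.exists_pos_refl b a
  rw [← hda] at h hne ⊢
  have hdc : d ≠ c := fun h => hne (by rw [h])
  refine ⟨_, D.mul_refl_comm u c d, ?_⟩
  rw [mul_refl_comm]
  refine D.length_lt_mul_refl b (D.affHeight_simple_act_pos hinv hd hdc) ?_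
  rw [← actAffine_mul, mul_refl_mul_refl]
  exact D.affHeight_pos_of_length_lt b hd h

theorem cov_mul_simple {u : D.ExtWeyl} (hu : 0 < affHeight b (D.actAffine u c)) :
    D.Cov b u (u * D.refl c) := ⟨c, rfl, D.length_mul_simple_of_pos hinv hu⟩

theorem cov_of_mul_simple {u : D.ExtWeyl} (hu : affHeight b (D.actAffine u c) < 0) :
    D.Cov b (u * D.refl c) u :=
  ⟨c, (D.mul_refl_mul_refl u c).symm, (D.length_mul_simple_of_neg hinv hu).symm⟩

/-- The lifting property for a whole chain. While `q < q s`, multiplication by `s` turns each cover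
into a cover. At a step where `s` becomes a descent, `length_simple_lt` forces the step to be `q < q
s` itself, and from there the original chain is followed. -/
theorem lift_chain {p q : D.ExtWeyl} (hp : 0 < affHeight b (D.actAffine p c))
    (h : Relation.ReflTransGen (D.Cov b) p q) :
    (0 < affHeight b (D.actAffine q c) →
      Relation.ReflTransGen (D.Cov b) (p * D.refl c) (q * D.refl c)) ∧
    (affHeight b (D.actAffine q c) < 0 →
      Relation.ReflTransGen (D.Cov b) (p * D.refl c) q) := by
  induction h with
  | refl => exact ⟨fun _ => .refl, fun h => absurd hp (by omega)⟩
  | @tail q r hpq hqr ih =>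
    obtain ⟨a, rfl, hl⟩ := hqr
    have hq0 := affHeight_ne_zero b (D.actAffine q c)
    by_cases hq : 0 < affHeight b (D.actAffine q c)
    · have ih := ih.1 hq
      by_cases hne : q * D.refl a = q * D.refl c
      · rw [hne]
        have hneg : affHeight b (D.actAffine (q * D.refl c) c) < 0 := by
          rw [affHeight_mul_refl_self]; omega
        exact ⟨fun h => absurd h (by omega), fun _ => ih⟩
      obtain ⟨a', h1, h2⟩ := D.length_simple_lt hinv (by omega) hne
      have l1 := D.length_mul_simple_of_pos hinv hq
      constructor
      · intro h
        refine ih.tail ⟨a', h1, ?_⟩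
        have := D.length_mul_simple_of_pos hinv h
        omega
      · intro h
        have := D.length_mul_simple_of_neg hinv h
        omega
    · have ih := (ih.2 (by omega)).tail ⟨a, rfl, hl⟩
      exact ⟨fun h => ih.tail (D.cov_mul_simple hinv h), fun _ => ih⟩

end Simple

/-- The chain property: every reflection which increases the length is a chain of covers. -/
theorem reflTransGen_cov [P.IsReduced] {u : D.ExtWeyl} {a : ι × ℤ}
    (h : D.length b u < D.length b (u * D.refl a)) :
    Relation.ReflTransGen (D.Cov b) u (u * D.refl a) := by
  generalize hn : D.length b (u * D.refl a) = n
  induction n using Nat.strong_induction_on generalizing u a with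
  | _ n ih =>
    -- With `v = u r` and `s` a simple descent of `v`, unless `v = u s`, induction gives a chain
    -- from `u s` to `v s`. It is extended at both ends if `u < u s`, and lifted by `s` otherwise.
    obtain ⟨c, hc, hvc, hinv⟩ := D.exists_simple b (v := u * D.refl a) (by omega)
    have hvs := D.length_mul_simple_of_neg hinv hvc
    by_cases hne : u * D.refl a = u * D.refl c
    · rw [hne] at hvc ⊢
      refine .single (D.cov_mul_simple hinv ?_)
      rw [affHeight_mul_refl_self] at hvc; omega
    obtain ⟨a', h1, h2⟩ := D.length_simple_lt hinv h hne
    have hch : Relation.ReflTransGen (D.Cov b) (u * D.refl c) (u * D.refl a * D.refl c) := by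
      rw [h1] at h2 hvs ⊢
      exact ih _ (by omega) h2 rfl
    have hu0 := affHeight_ne_zero b (D.actAffine u c)
    by_cases hu : 0 < affHeight b (D.actAffine u c)
    · exact (hch.head (D.cov_mul_simple hinv hu)).tail (D.cov_of_mul_simple hinv hvc)
    · have := (D.lift_chain hinv (by rw [affHeight_mul_refl_self]; omega) hch).1
        (by rw [affHeight_mul_refl_self]; omega)
      rwa [mul_refl_mul_refl, mul_refl_mul_refl] at this

theorem bruhatLE_iff_cov [P.IsReduced] {u v : D.ExtWeyl} :
    D.BruhatLE b u v ↔ Relation.ReflTransGen (D.Cov b) u v := by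
  constructor
  · intro h
    induction h with
    | refl => exact .refl
    | tail _ h ih =>
      obtain ⟨i, k, rfl, hl⟩ := h
      have he : D.affineReflection i k = D.refl (i, -k) := by simp [refl]
      rw [he] at hl ⊢
      exact ih.trans (D.reflTransGen_cov b hl)
  · intro h
    induction h with
    | refl => exact .refl
    | tail _ h ih =>
      obtain ⟨a, rfl, hl⟩ := h
      exact ih.tail ⟨a.1, -a.2, rfl, by omega⟩

end CocharacterDatum
end

/-! ### Dominance order and the length formula. -/

noncomputable section
open RootPairing
set_option linter.unusedSectionVars false

namespace RootPairing.Base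

variable {ι V V' : Type*} [AddCommGroup V] [Module ℚ V] [AddCommGroup V'] [Module ℚ V']
variable {P : RootPairing ι ℚ V V'} (b : P.Base)
variable [Finite ι] [P.IsCrystallographic] [P.IsReduced]

theorem length_mul_simple_lt {w : P.weylGroup} {i : ι} (hi : i ∈ b.support)
    (hw : ¬ b.IsPos (P.weylGroupToPerm w i)) :
    b.length (w * weylGroup.ofIdx P i) < b.length w := by
  have hip := isPos_of_mem_support hi
  have hmem : i ∈ {j : ι | b.IsPos j ∧ ¬ b.IsPos (P.weylGroupToPerm w j)} := ⟨hip, hw⟩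
  refine lt_of_le_of_lt ?_ (Set.ncard_sdiff_singleton_lt_of_mem hmem)
  refine Set.ncard_le_ncard_of_injOn (P.reflectionPerm i) ?_ (P.reflectionPerm i).injective.injOn
  rintro j ⟨h1, h2⟩
  rw [weylGroupToPerm_mul, weylGroupToPerm_ofIdx] at h2
  have hji : j ≠ i := by
    rintro rfl
    rw [not_isPos_iff] at h2 hw
    rw [height_perm_neg] at h2
    omega
  refine ⟨⟨h1.reflectionPerm hi hji, h2⟩, fun (h : _ = i) => ?_⟩
  have h3 := congrArg (P.reflectionPerm i) h
  rw [reflectionPerm_self] at h3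
  rw [h3, isPos_neg_iff] at h1
  exact h1 hip

/-- Induction on positive roots through simple reflections which decrease the height. -/
theorem IsPos.induction_pairing {i : ι} (h₀ : b.IsPos i) {p : ι → Prop}
    (h₁ : ∀ i ∈ b.support, p i)
    (h₂ : ∀ i j, p i → j ∈ b.support → P.pairingIn ℤ i j < 0 → p (P.reflectionPerm j i)) :
    p i := by
  generalize hN : (b.height i).toNat = N
  induction N using Nat.strongRecOn generalizing i with
  | ind n ih =>
    obtain ⟨j, hj, hj'⟩ := h₀.exists_mem_support_pos_pairingIn
    rw [P.zero_lt_pairingIn_iff'] at hj'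
    rcases eq_or_ne i j with rfl | hij
    · exact h₁ i hj
    have hk := h₀.reflectionPerm hj hij
    have hh := b.height_reflectionPerm j i
    rw [height_one_of_mem_support hj, mul_one] at hh
    rw [isPos_iff] at h₀
    have := h₂ (P.reflectionPerm j i) j (ih _ (by omega) hk rfl) hj
      (by rw [pairingIn_ofIdx_left]; omega)
    rwa [reflectionPerm_self] at this

end RootPairing.Base

namespace CocharacterDatum

variable {ι V V' X : Type*} [AddCommGroup V] [Module ℚ V] [AddCommGroup V'] [Module ℚ V']
variable {P : RootPairing ι ℚ V V'} [P.IsCrystallographic] [P.IsReduced]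
variable [AddCommGroup X] [DistribMulAction P.weylGroup X]
variable (D : CocharacterDatum P X) (b : P.Base)
variable [Fintype ι]

/-- The functional `x ↦ ⟨x, 2ρ⟩`, where `2ρ` is the sum of the positive roots. -/
def twoRho : X →+ ℤ := ∑ i ∈ b.posRoots, D.root i

theorem twoRho_apply (x : X) : D.twoRho b x = ∑ i ∈ b.posRoots, D.root i x := by
  simp [twoRho]

theorem twoRho_coroot (i : ι) : D.twoRho b (D.coroot i) = 2 * b.corootRho i := by
  rw [twoRho_apply, ← b.sum_pairingIn_eq]
  exact Finset.sum_congr rfl fun j _ => D.root_coroot j i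

theorem twoRho_coroot_simple {i : ι} (hi : i ∈ b.support) : D.twoRho b (D.coroot i) = 2 := by
  rw [twoRho_apply, ← b.sum_pairingIn_simple hi]
  exact Finset.sum_congr rfl fun j _ => D.root_coroot j i

/-- The cone of sums of simple coroots. -/
def cone : AddSubmonoid X := AddSubmonoid.closure (D.coroot '' (b.support : Set ι))

theorem domLE_iff {x y : X} : D.DomLE b x y ↔ y - x ∈ D.cone b := Iff.rfl

theorem zsmul_mem_cone {x : X} (hx : x ∈ D.cone b) {k : ℤ} (hk : 0 ≤ k) : k • x ∈ D.cone b := by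
  lift k to ℕ using hk
  rw [natCast_zsmul]
  exact AddSubmonoid.nsmul_mem _ hx k

theorem coroot_mem_cone_of_simple {i : ι} (hi : i ∈ b.support) : D.coroot i ∈ D.cone b :=
  AddSubmonoid.subset_closure ⟨i, hi, rfl⟩

theorem coroot_mem_cone {i : ι} (hi : b.IsPos i) : D.coroot i ∈ D.cone b := by
  refine Base.IsPos.induction_pairing b hi (p := fun i => D.coroot i ∈ D.cone b)
    (fun i hi => D.coroot_mem_cone_of_simple b hi) fun i j h hj hij => ?_
  rw [coroot_reflectionPerm, sub_eq_add_neg, ← neg_smul]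
  rw [P.pairingIn_lt_zero_iff] at hij
  exact add_mem h (D.zsmul_mem_cone b (D.coroot_mem_cone_of_simple b hj) (by omega))

theorem twoRho_nonneg {x : X} (hx : x ∈ D.cone b) : 0 ≤ D.twoRho b x := by
  induction hx using AddSubmonoid.closure_induction with
  | mem x hx =>
    obtain ⟨i, hi, rfl⟩ := hx
    rw [D.twoRho_coroot_simple b hi]; norm_num
  | zero => rw [map_zero]
  | add x y _ _ hx hy => rw [map_add]; omega

theorem domLE_refl (x : X) : D.DomLE b x x := by
  rw [domLE_iff, sub_self]; exact zero_mem _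

variable {b} in
theorem DomLE.trans {D : CocharacterDatum P X} {x y z : X} (h : D.DomLE b x y)
    (h' : D.DomLE b y z) : D.DomLE b x z := by
  have := add_mem h' h
  rwa [sub_add_sub_cancel] at this

theorem le_root_of_simple {m : ℤ} (hm : 0 ≤ m) {x : X} (hx : ∀ i ∈ b.support, m ≤ D.root i x)
    {i : ι} (hi : b.IsPos i) : m ≤ D.root i x := by
  refine Base.IsPos.induction_pairing b hi (p := fun i => m ≤ D.root i x) hx
    fun i j h hj hij => ?_
  rw [root_reflectionPerm]
  have := hx j hj
  nlinarith

/-- If `w α_i` is negative, then `w s_i x` differs from `w x` by a nonnegative multiple of the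
positive coroot `-w α_i^∨`, and `w s_i` is shorter. -/
theorem smul_domLE {x : X} (hx : D.IsDominant b x) (w : P.weylGroup) : D.DomLE b (w • x) x := by
  generalize hn : b.length w = n
  induction n using Nat.strong_induction_on generalizing w with
  | _ n ih =>
    by_cases hw : w = 1
    · rw [hw, one_smul]; exact D.domLE_refl b x
    obtain ⟨i, hi, hneg⟩ := b.exists_simple_neg hw
    have h1 := ih _ (hn ▸ b.length_mul_simple_lt hi hneg) (w * weylGroup.ofIdx P i) rfl
    refine DomLE.trans ?_ h1
    rw [domLE_iff, mul_smul, D.reflection_smul, smul_sub, smul_zsmul_eq, D.smul_coroot,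
      sub_sub_cancel_left, ← smul_neg, ← coroot_neg]
    exact D.zsmul_mem_cone b (D.coroot_mem_cone b ((b.isPos_neg_iff _).2 hneg)) (hx i hi)

/-- A point of the orbit with the largest pairing with `2ρ` is dominant, since a simple reflection
changes this pairing by `-2⟨x, α_i⟩`. -/
theorem exists_smul_isDominant (x : X) : ∃ w : P.weylGroup, D.IsDominant b (w • x) := by
  have := Base.finite_weylGroup b
  obtain ⟨w, hw⟩ := Finite.exists_max fun w : P.weylGroup => D.twoRho b (w • x)
  refine ⟨w, fun i hi => ?_⟩
  have h := hw (weylGroup.ofIdx P i * w)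
  rw [mul_smul, D.reflection_smul, map_sub, map_zsmul, D.twoRho_coroot_simple b hi,
    smul_eq_mul] at h
  omega

theorem eq_one_of_smul_isDominant {x : X} (hx : ∀ i ∈ b.support, 0 < D.root i x)
    {w : P.weylGroup} (hw : D.IsDominant b (w • x)) : w = 1 := by
  by_contra hne
  obtain ⟨i, hi, hneg⟩ := b.exists_simple_neg hne
  have h1 := D.le_root_of_simple b le_rfl hw ((b.isPos_neg_iff _).2 hneg)
  rw [root_neg, D.root_smul] at h1
  have := hx i hi
  omega

/-- A point of the segment between `v` and `s_α v` is dominated by `v`. -/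
theorem domLE_of_segment {l l' v : X} (hl' : D.IsDominant b l') {u w : P.weylGroup}
    (hv : v = w • l') {i : ι} {j : ℤ} (hj : 0 ≤ j) (hj' : j ≤ D.root i v)
    (hu : u • l = v - j • D.coroot i) : D.DomLE b l l' := by
  have hl : l = u⁻¹ • (v - j • D.coroot i) := by rw [← hu, inv_smul_smul]
  -- After applying `u⁻¹`, one end of the segment, `v` or `s_α v`, lies above the point; the sign of
  -- `u⁻¹ α` decides which. Both ends are in the orbit of `l'`.
  by_cases hp : b.IsPos (P.weylGroupToPerm u⁻¹ i)
  · have h1 := D.smul_domLE b hl' (u⁻¹ * w)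
    rw [domLE_iff, mul_smul, ← hv] at h1
    have h2 := add_mem h1 (D.zsmul_mem_cone b (D.coroot_mem_cone b hp) hj)
    rw [domLE_iff, hl, smul_sub, smul_zsmul_eq, D.smul_coroot]
    convert h2 using 1
    abel
  · have h1 := D.smul_domLE b hl' (u⁻¹ * (weylGroup.ofIdx P i * w))
    rw [domLE_iff, mul_smul, mul_smul, ← hv, D.reflection_smul, smul_sub, smul_zsmul_eq,
      D.smul_coroot] at h1
    have h2 := add_mem h1 (D.zsmul_mem_cone b (D.coroot_mem_cone b ((b.isPos_neg_iff _).2 hp))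
      (sub_nonneg.2 hj'))
    rw [domLE_iff, hl, smul_sub, smul_zsmul_eq, D.smul_coroot]
    rw [coroot_neg] at h2
    convert h2 using 1
    rw [smul_neg, sub_smul]
    abel

theorem fin_mul_t_mul_fin (x y : P.weylGroup) (l : X) :
    D.fin x * D.t l * D.fin y = D.t (x • l) * D.fin (x * y) := by
  rw [fin_mul_t, mul_assoc, fin_mul_fin]

open Classical in
/-- `0` for positive roots and `1` for negative roots. -/
def negInd (i : ι) : ℤ := if b.IsPos i then 0 else 1

theorem negInd_nonneg (i : ι) : 0 ≤ negInd b i := by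
  rw [negInd]; split_ifs <;> norm_num

theorem negInd_le (i : ι) : negInd b i ≤ 1 := by
  rw [negInd]; split_ifs <;> norm_num

theorem sum_negInd (w : P.weylGroup) :
    ∑ i ∈ b.posRoots, negInd b (P.weylGroupToPerm w i) = b.length w := by
  classical
  have hset : {i : ι | b.IsPos i ∧ ¬ b.IsPos (P.weylGroupToPerm w i)} =
      ↑(b.posRoots.filter fun i => ¬ b.IsPos (P.weylGroupToPerm w i)) := by
    ext i
    simp only [Set.mem_ofPred_eq, Finset.coe_filter, Base.mem_posRoots]
  rw [Base.length, hset, Set.ncard_coe_finset, Finset.card_filter, Nat.cast_sum]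
  refine Finset.sum_congr rfl fun i _ => ?_
  rw [negInd]
  split_ifs <;> simp_all

theorem isPosAffine_iff_negInd (a : ι × ℤ) : IsPosAffine b a ↔ negInd b a.1 ≤ a.2 := by
  rw [IsPosAffine, negInd]
  split_ifs with h <;> simp [h]

/-- For each gradient, the inverted affine roots form an interval of constants `k`; `toNat` covers
the empty ones. -/
theorem length_t_mul_fin (l : X) (w : P.weylGroup) :
    D.length b (D.t l * D.fin w) = ∑ i, (D.root (P.weylGroupToPerm w i) l +
      negInd b (P.weylGroupToPerm w i) - negInd b i).toNat := by
  classical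
  have hset : {a : ι × ℤ | IsPosAffine b a ∧
      ¬ IsPosAffine b (D.actAffine (D.t l * D.fin w) a)} =
      ↑((Finset.univ.sigma fun i : ι => Finset.Ico (negInd b i)
        (D.root (P.weylGroupToPerm w i) l + negInd b (P.weylGroupToPerm w i))).map
          (Equiv.sigmaEquivProd ι ℤ).toEmbedding) := by
    ext ⟨i, k⟩
    simp only [Set.mem_ofPred_eq, isPosAffine_iff_negInd, actAffine_t_mul_fin, Finset.coe_map,
      Set.mem_image, Finset.mem_coe, Finset.mem_sigma, Finset.mem_univ, true_and, Finset.mem_Ico]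
    constructor
    · rintro ⟨h1, h2⟩
      exact ⟨⟨i, k⟩, ⟨h1, by simp only; omega⟩, rfl⟩
    · rintro ⟨⟨i', k'⟩, ⟨h1, h2⟩, h⟩
      obtain ⟨rfl, rfl⟩ : i' = i ∧ k' = k := by simpa using h
      simp only at h1 h2
      exact ⟨h1, by omega⟩
  rw [length, hset, Set.ncard_coe_finset, Finset.card_map, Finset.card_sigma]
  simp [Int.card_Ico]

/-- The length formula for `x t^l y` with `l` dominant and regular. -/
theorem length_formula {l : X} (hl : ∀ i ∈ b.support, 0 < D.root i l) (x y : P.weylGroup) :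
    (D.length b (D.fin x * D.t l * D.fin y) : ℤ) =
      D.twoRho b l + b.length x - b.length y⁻¹ := by
  classical
  rw [fin_mul_t_mul_fin, length_t_mul_fin, ← Equiv.sum_comp (P.weylGroupToPerm y⁻¹)]
  simp only [weylGroupToPerm_mul, weylGroupToPerm_apply_inv, D.root_smul]
  rw [twoRho_apply, ← sum_negInd, ← sum_negInd, ← Finset.sum_add_distrib,
    ← Finset.sum_sub_distrib, Nat.cast_sum]
  symm
  -- Since `|⟨l, α⟩| ≥ 1` outweighs the indicators, negative roots contribute 0, and on positive
  -- roots the truncation does nothing.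
  refine Finset.sum_subset_zero_on_sdiff (Finset.subset_univ _) ?_ ?_
  · intro i hi
    simp only [Finset.mem_sdiff, Finset.mem_univ, true_and, Base.mem_posRoots] at hi
    have h1 := D.le_root_of_simple b (m := 1) (by norm_num) hl ((b.isPos_neg_iff _).2 hi)
    rw [root_neg] at h1
    have h2 := negInd_le b (P.weylGroupToPerm x i)
    have h3 := negInd_nonneg b (P.weylGroupToPerm y⁻¹ i)
    omega
  · intro i hi
    have h1 := D.le_root_of_simple b (m := 1) (by norm_num) hl (b.mem_posRoots.1 hi)
    have h2 := negInd_nonneg b (P.weylGroupToPerm x i)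
    have h3 := negInd_le b (P.weylGroupToPerm y⁻¹ i)
    omega

end CocharacterDatum
end

/-! ### Bruhat covers and edges of the quantum Bruhat graph. -/

noncomputable section
open RootPairing
set_option linter.unusedSectionVars false

namespace CocharacterDatum

variable {ι V V' X : Type*} [AddCommGroup V] [Module ℚ V] [AddCommGroup V'] [Module ℚ V']
variable {P : RootPairing ι ℚ V V'} [P.IsCrystallographic] [P.IsReduced]
variable [AddCommGroup X] [DistribMulAction P.weylGroup X]
variable (D : CocharacterDatum P X) (b : P.Base)
variable [Fintype ι]

theorem mul_refl_eq (x y : P.weylGroup) (l : X) (a : ι × ℤ) :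
    D.fin x * D.t l * D.fin y * D.refl a =
      D.fin x * D.t (l - a.2 • D.coroot (P.weylGroupToPerm y a.1)) *
        D.fin (weylGroup.ofIdx P (P.weylGroupToPerm y a.1) * y) := by
  have h : D.fin y * D.refl a = D.t (-(a.2 • D.coroot (P.weylGroupToPerm y a.1))) *
      D.fin (weylGroup.ofIdx P (P.weylGroupToPerm y a.1) * y) := by
    rw [refl_eq, ← mul_assoc, fin_mul_t, mul_assoc, fin_mul_fin, mul_ofIdx, smul_zsmul_eq,
      D.smul_coroot, neg_smul]
  rw [mul_assoc _ (D.fin y), h, sub_eq_add_neg, ← t_mul_t]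
  simp only [mul_assoc]

/-- Carrying a reflection across the translation allows a right multiplication to be read as a
change of the left factor. -/
theorem fin_mul_t_mul_fin_ofIdx (x y : P.weylGroup) (l : X) (i : ι) :
    D.fin x * D.t l * D.fin (weylGroup.ofIdx P i * y) =
      D.fin (x * weylGroup.ofIdx P i) * D.t (l - D.root i l • D.coroot i) * D.fin y := by
  rw [fin_mul_t_mul_fin, fin_mul_t_mul_fin, ← D.reflection_smul, mul_smul, ← mul_smul _ _ l,
    ofIdx_mul_self, one_smul, mul_assoc]

/-- The shape of the product of `x' t^{l'} y'` with a reflection which decreases the length. -/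
theorem exists_of_length_lt {x y x' y' : P.weylGroup} {l l' : X} {a : ι × ℤ}
    (h : D.fin x' * D.t l' * D.fin y' = D.fin x * D.t l * D.fin y * D.refl a)
    (hlt : D.length b (D.fin x * D.t l * D.fin y) < D.length b (D.fin x' * D.t l' * D.fin y')) :
    ∃ (i : ι) (k : ℤ), 0 ≤ k ∧ k ≤ D.root i l' ∧ (x'⁻¹ * x) • l = l' - k • D.coroot i ∧
      x * y = x' * weylGroup.ofIdx P i * y' := by
  obtain ⟨c, hc, hca⟩ := D.exists_pos_refl b a
  have hu : D.fin x * D.t l * D.fin y = D.fin x' * D.t l' * D.fin y' * D.refl c := by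
    rw [hca, h, mul_refl_mul_refl]
  have hneg : ¬ IsPosAffine b (D.actAffine (D.fin x' * D.t l' * D.fin y') c) := by
    rw [isPosAffine_iff]
    intro hpos
    have := D.length_lt_mul_refl b hc hpos
    rw [← hu] at this
    omega
  rw [← isPosAffine_iff, isPosAffine_iff_negInd] at hc
  rw [isPosAffine_iff_negInd, fin_mul_t_mul_fin, actAffine_t_mul_fin, weylGroupToPerm_mul,
    D.root_smul] at hneg
  simp only at hneg
  have h1 := negInd_nonneg b c.1
  have h2 := negInd_le b (P.weylGroupToPerm x' (P.weylGroupToPerm y' c.1))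
  rw [mul_refl_eq, fin_mul_t_mul_fin, fin_mul_t_mul_fin] at hu
  obtain ⟨h3, h4⟩ := D.t_mul_fin_inj hu
  -- Positivity of `c` gives `0 ≤ k`. That it becomes negative gives `k - ⟨l', α⟩ < negInd ≤ 1`,
  -- hence `k ≤ ⟨l', α⟩`.
  exact ⟨P.weylGroupToPerm y' c.1, c.2, by omega, by omega,
    by rw [mul_smul, h3, inv_smul_smul], by rw [h4, mul_assoc]⟩

/-- The Bruhat order refines the dominance order. -/
theorem domLE_of_length_lt {x y x' y' : P.weylGroup} {l l' : X} {a : ι × ℤ}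
    (h : D.fin x' * D.t l' * D.fin y' = D.fin x * D.t l * D.fin y * D.refl a)
    (hlt : D.length b (D.fin x * D.t l * D.fin y) < D.length b (D.fin x' * D.t l' * D.fin y'))
    (hl' : D.IsDominant b l') : D.DomLE b l l' := by
  obtain ⟨i, k, h1, h2, h3, -⟩ := D.exists_of_length_lt b h hlt
  exact D.domLE_of_segment b hl' (one_smul _ _).symm h1 h2 h3

variable {b} in
theorem QBGPath.trans {D : CocharacterDatum P X} {x y z : P.weylGroup} {γ δ : X}
    (p : D.QBGPath b x y γ) (q : D.QBGPath b y z δ) : D.QBGPath b x z (γ + δ) := by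
  induction q with
  | nil => rwa [add_zero]
  | up i _ hi h ih => exact .up i ih hi h
  | down i _ hi h ih => rw [← add_assoc]; exact .down i ih hi h

/-- `length_le_length_mul_ofIdx` leaves only `k = 0`, an upward edge, and `k = 1`, a downward edge.
-/
theorem qbgPath_of_length {w : P.weylGroup} {i : ι} (hi : b.IsPos i) {k : ℤ} (hk : 0 ≤ k)
    (h : 2 * k * b.corootRho i + b.length (w * weylGroup.ofIdx P i) = b.length w + 1) :
    D.QBGPath b w (w * weylGroup.ofIdx P i) (k • D.coroot i) := by
  have h1 := b.length_le_length_mul_ofIdx w hi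
  have h2 := b.corootRho_pos hi
  have hk1 : k ≤ 1 := by nlinarith
  obtain rfl | rfl : k = 0 ∨ k = 1 := by omega
  · rw [zero_smul]
    exact .up i (.nil w) hi (by omega)
  · rw [one_smul, ← zero_add (D.coroot i)]
    exact .down i (.nil w) hi (by omega)

/-- The covers between elements whose translation parts are far from the walls
are given by the edges of the quantum Bruhat graph. -/
theorem qbgPath_of_cov {L c : ℤ} (hL : ∀ w, (b.length w : ℤ) ≤ L)
    (hc : ∀ i j, P.pairingIn ℤ i j ≤ c) (hc2 : 0 < c) {x y x' y' : P.weylGroup} {l l' : X}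
    (hl : ∀ i ∈ b.support, c * (L + 1) ≤ D.root i l)
    (hl' : ∀ i ∈ b.support, c * (L + 1) ≤ D.root i l')
    (hcov : D.Cov b (D.fin x * D.t l * D.fin y) (D.fin x' * D.t l' * D.fin y')) :
    (x = x' ∧ D.QBGPath b y'⁻¹ y⁻¹ (l' - l)) ∨ (y = y' ∧ D.QBGPath b x x' (l' - l)) := by
  obtain ⟨a, ha, hlen⟩ := hcov
  have hL0 : 0 ≤ L := le_trans (Int.natCast_nonneg _) (hL 1)
  have hcL : 0 < c * (L + 1) := mul_pos hc2 (by omega)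
  have hlr : ∀ i ∈ b.support, 0 < D.root i l := fun i hi => hcL.trans_le (hl i hi)
  have hlr' : ∀ i ∈ b.support, 0 < D.root i l' := fun i hi => hcL.trans_le (hl' i hi)
  obtain ⟨i, k, hk0, hk, hxl, hxy⟩ := D.exists_of_length_lt b ha (by omega)
  have hi : b.IsPos i := by
    by_contra hn
    have h1 := D.le_root_of_simple b (m := 1) (by norm_num) hlr' ((b.isPos_neg_iff _).2 hn)
    rw [root_neg] at h1
    omega
  have hlen' : D.twoRho b l' + b.length x' - b.length y'⁻¹ =
      D.twoRho b l + b.length x - b.length y⁻¹ + 1 := by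
    rw [← D.length_formula b hlr', ← D.length_formula b hlr, hlen]
    push_cast; ring
  have hρ := b.corootRho_pos hi
  -- This fixes the depth bound: `L + 1` steps along a coroot lower a simple pairing by at most `c *
  -- (L + 1)`.
  have hdom : ∀ j : ℤ, 0 ≤ j → j ≤ L + 1 → D.IsDominant b (l' - j • D.coroot i) := by
    intro j hj hjL m hm
    rw [map_sub, map_zsmul, D.root_coroot, smul_eq_mul]
    have h1 : j * P.pairingIn ℤ m i ≤ j * c := mul_le_mul_of_nonneg_left (hc m i) hj
    have h2 : j * c ≤ (L + 1) * c := mul_le_mul_of_nonneg_right hjL hc2.le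
    have h3 := hl' m hm
    linarith
  -- On the half of the segment nearer to `l'`, a point within `L + 1` steps is dominant, and
  -- regularity of `l` forces `w = 1`. A farther point would give `⟨l' - l, 2ρ⟩ ≥ 2L + 2`, against
  -- the maximum `2L + 1` for a cover.
  have key : ∀ (w : P.weylGroup) (j : ℤ), 0 ≤ j → 2 * j ≤ D.root i l' →
      w • l = l' - j • D.coroot i → w = 1 := by
    intro w j hj hj2 hw
    by_cases hjL : j ≤ L + 1
    · exact D.eq_one_of_smul_isDominant b hlr (hw ▸ hdom j hj hjL)
    exfalso
    have hseg : D.DomLE b l (l' - (L + 1) • D.coroot i) := by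
      refine D.domLE_of_segment b (u := w) (i := i) (j := j - (L + 1))
        (hdom (L + 1) (by omega) le_rfl) (one_smul _ _).symm (by omega) ?_ ?_
      · rw [map_sub, map_zsmul, D.root_coroot, pairingIn_same, smul_eq_mul]
        omega
      · rw [hw]; module
    have h1 := D.twoRho_nonneg b ((D.domLE_iff b).1 hseg)
    rw [map_sub, map_sub, map_zsmul, twoRho_coroot, smul_eq_mul] at h1
    have h2 : (L + 1) * 1 ≤ (L + 1) * b.corootRho i :=
      mul_le_mul_of_nonneg_left hρ (by omega)
    have := hL x
    have := hL y'⁻¹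
    have : (0 : ℤ) ≤ b.length x' := Int.natCast_nonneg _
    have : (0 : ℤ) ≤ b.length y⁻¹ := Int.natCast_nonneg _
    linarith
  by_cases hk2 : 2 * k ≤ D.root i l'
  · left
    have hw := key _ k hk0 hk2 hxl
    have hxx : x = x' := (inv_mul_eq_one.1 hw).symm
    rw [hw, one_smul] at hxl
    subst hxx
    have hy : y⁻¹ = y'⁻¹ * weylGroup.ofIdx P i := by
      rw [mul_assoc] at hxy
      rw [mul_left_cancel hxy, mul_inv_rev, ofIdx_inv]
    have hll : l' - l = k • D.coroot i := by rw [hxl]; abel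
    refine ⟨rfl, ?_⟩
    rw [hll, hy]
    refine D.qbgPath_of_length b hi hk0 ?_
    rw [← hy]
    have := congrArg (D.twoRho b) hll
    rw [map_sub, map_zsmul, twoRho_coroot, smul_eq_mul] at this
    linarith
  · right
    -- The other half is reduced to `key` by reflecting in `α`, which replaces `k` by `⟨l', α⟩ - k`.
    have hsl : (weylGroup.ofIdx P i * (x'⁻¹ * x)) • l = l' - (D.root i l' - k) • D.coroot i := by
      rw [mul_smul, hxl, D.reflection_smul, map_sub, map_zsmul, D.root_coroot, pairingIn_same]
      simp only [smul_eq_mul]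
      module
    have hw := key _ _ (by omega) (by omega) hsl
    rw [hw, one_smul] at hsl
    have hx : x' = x * weylGroup.ofIdx P i := by
      rw [← mul_assoc, mul_eq_one_iff_eq_inv] at hw
      have h1 : x = x' * weylGroup.ofIdx P i := by
        have h2 := congrArg (·⁻¹) hw
        simp only [inv_inv, mul_inv_rev, ofIdx_inv] at h2
        exact h2.symm
      rw [h1, mul_assoc, ofIdx_mul_self, mul_one]
    have hy : y = y' := by
      rw [hx, mul_assoc x, ofIdx_mul_self, mul_one] at hxy
      exact mul_left_cancel hxy
    have hll : l' - l = (D.root i l' - k) • D.coroot i := by rw [hsl]; abel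
    refine ⟨hy, ?_⟩
    rw [hll, hx]
    refine D.qbgPath_of_length b hi (by omega) ?_
    rw [← hx]
    have := congrArg (D.twoRho b) hll
    rw [map_sub, map_zsmul, twoRho_coroot, smul_eq_mul] at this
    rw [hy] at hlen'
    linarith

theorem exists_normal_form (u : D.ExtWeyl) :
    ∃ x l y, D.IsDominant b l ∧ u = D.fin x * D.t l * D.fin y := by
  obtain ⟨z, w, rfl⟩ := D.exists_eq_t_mul_fin u
  obtain ⟨v, hv⟩ := D.exists_smul_isDominant b z
  exact ⟨v⁻¹, v • z, v * w, hv, by rw [fin_mul_t_mul_fin, inv_smul_smul, inv_mul_cancel_left]⟩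

/-- The depth hypothesis applies only between `λ` and `μ`. The bound by `λ` is passed up the chain;
the bound by `μ` comes back down with the path, so both are proved together. -/
theorem qbgPath_of_chain {L c : ℤ} (hL : ∀ w, (b.length w : ℤ) ≤ L)
    (hc : ∀ i j, P.pairingIn ℤ i j ≤ c) (hc2 : 0 < c) {lam μ : X} (hμ : D.IsDominant b μ)
    (hdepth : ∀ l, D.IsDominant b l → D.DomLE b lam l → D.DomLE b l μ →
      ∀ i ∈ b.support, c * (L + 1) ≤ D.root i l) {z : P.weylGroup} {u : D.ExtWeyl}
    (hu : Relation.ReflTransGen (D.Cov b) u (D.t (z • μ))) :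
    ∀ {x y : P.weylGroup} {l : X}, D.IsDominant b l → D.DomLE b lam l →
      u = D.fin x * D.t l * D.fin y → D.DomLE b l μ ∧ D.QBGPath b x y⁻¹ (μ - l) := by
  have hL0 : 0 ≤ L := le_trans (Int.natCast_nonneg _) (hL 1)
  have hcL : 0 < c * (L + 1) := mul_pos hc2 (by omega)
  induction hu using Relation.ReflTransGen.head_induction_on with
  | refl =>
    intro x y l hl hlam he
    rw [fin_mul_t_mul_fin, ← mul_one (D.t (z • μ)), ← D.fin_one] at he
    obtain ⟨h1, h2⟩ := D.t_mul_fin_inj he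
    have h3 : l = (x⁻¹ * z) • μ := by rw [mul_smul, h1, inv_smul_smul]
    have h4 : D.DomLE b l μ := h3 ▸ D.smul_domLE b hμ _
    have h5 : (z⁻¹ * x) • l = μ := by rw [mul_smul, ← h1, inv_smul_smul]
    -- At the top `l` is regular and `z⁻¹ x` carries it to the dominant `μ`, so `x = z = y⁻¹` and
    -- the path is empty.
    have h6 := D.eq_one_of_smul_isDominant b
      (fun i hi => hcL.trans_le (hdepth l hl hlam h4 i hi)) (h5 ▸ hμ)
    rw [h6, one_smul] at h5
    refine ⟨h4, ?_⟩
    rw [h5, sub_self, ← eq_inv_of_mul_eq_one_left h2.symm]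
    exact .nil x
  | head hcov _ ih =>
    intro x y l hl hlam he
    rename_i u v _
    obtain ⟨x', l', y', hl', rfl⟩ := D.exists_normal_form b v
    subst he
    have hcov' := hcov
    obtain ⟨a, ha, hlen⟩ := hcov'
    have hll := D.domLE_of_length_lt b ha (by omega) hl'
    obtain ⟨h1, h2⟩ := ih hl' (hlam.trans hll) rfl
    refine ⟨hll.trans h1, ?_⟩
    have hsum : μ - l = (l' - l) + (μ - l') := by abel
    have hsum' : μ - l = (μ - l') + (l' - l) := by abel
    rcases D.qbgPath_of_cov b hL hc hc2 (hdepth l hl hlam (hll.trans h1))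
      (hdepth l' hl' (hlam.trans hll) h1) hcov with ⟨rfl, h3⟩ | ⟨rfl, h3⟩
    · rw [hsum']; exact h2.trans h3
    · rw [hsum]; exact h3.trans h2

/-- Both kinds of edge raise the length of `w t^{λ+γ} y` by exactly one: for a downward edge the
gain `⟨α^∨, 2ρ⟩` in the translation part offsets the drop of `ℓ(w)`. Depth at least `c` keeps `λ +
γ` dominant when a coroot is added. -/
theorem bruhatLE_of_qbgPath {c : ℤ} (hc0 : 0 < c) (hc : ∀ i j, -c ≤ P.pairingIn ℤ i j) {lam μ : X}
    (hlam : D.IsDominant b lam)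
    (hdepth : ∀ l, D.IsDominant b l → D.DomLE b lam l → D.DomLE b l μ →
      ∀ i ∈ b.support, c ≤ D.root i l) {x w : P.weylGroup} {γ : X} (p : D.QBGPath b x w γ)
    (y : P.weylGroup) (hγ : D.DomLE b (lam + γ) μ) :
    D.IsDominant b (lam + γ) ∧ D.DomLE b lam (lam + γ) ∧
      D.BruhatLE b (D.fin x * D.t lam * D.fin y) (D.fin w * D.t (lam + γ) * D.fin y) := by
  have step : ∀ (w : P.weylGroup) (l l' : X) (i : ι) (k : ℤ), l' = l + k • D.coroot i →
      D.length b (D.fin w * D.t l * D.fin y) <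
        D.length b (D.fin (w * weylGroup.ofIdx P i) * D.t l' * D.fin y) →
      ∃ (i' : ι) (k' : ℤ), D.fin (w * weylGroup.ofIdx P i) * D.t l' * D.fin y =
        D.fin w * D.t l * D.fin y * D.affineReflection i' k' ∧
        D.length b (D.fin w * D.t l * D.fin y) <
          D.length b (D.fin (w * weylGroup.ofIdx P i) * D.t l' * D.fin y) := by
    rintro w l l' i k rfl hlt
    -- Reflecting in `y⁻¹ α` with constant `⟨l, α⟩ + k` sends `l` to `s_α l - k α^∨ = s_α (l + k
    -- α^∨)`, and `s_α` then passes to the left factor.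
    refine ⟨P.weylGroupToPerm y⁻¹ i, -(D.root i l + k), ?_, hlt⟩
    have h := D.mul_refl_eq w y l (P.weylGroupToPerm y⁻¹ i, D.root i l + k)
    simp only [weylGroupToPerm_apply_inv] at h
    rw [fin_mul_t_mul_fin_ofIdx] at h
    rw [← refl.eq_1 D (P.weylGroupToPerm y⁻¹ i, D.root i l + k), h]
    congr 3
    rw [map_sub, map_zsmul, D.root_coroot, pairingIn_same]
    simp only [smul_eq_mul]
    module
  induction p with
  | nil =>
    rw [add_zero]
    exact ⟨hlam, D.domLE_refl b _, .refl⟩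
  | @up w γ i p hi h ih =>
    obtain ⟨h1, h2, h3⟩ := ih hγ
    have hr : ∀ i ∈ b.support, 0 < D.root i (lam + γ) := fun i hi =>
      hc0.trans_le (hdepth _ h1 h2 hγ i hi)
    refine ⟨h1, h2, h3.tail (step w _ _ i 0 (by simp) ?_)⟩
    have := D.length_formula b hr w y
    have := D.length_formula b hr (w * weylGroup.ofIdx P i) y
    omega
  | @down w γ i p hi h ih =>
    have hα := D.coroot_mem_cone b hi
    have hle : D.DomLE b (lam + γ) (lam + (γ + D.coroot i)) := by
      rw [domLE_iff, add_sub_add_left_eq_sub, add_sub_cancel_left]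
      exact hα
    obtain ⟨h1, h2, h3⟩ := ih (hle.trans hγ)
    have hr := hdepth _ h1 h2 (hle.trans hγ)
    have hdom : D.IsDominant b (lam + (γ + D.coroot i)) := by
      intro j hj
      have := hr j hj
      have := hc j i
      rw [← add_assoc, map_add, D.root_coroot]
      omega
    have hr' := hdepth _ hdom (h2.trans hle) hγ
    refine ⟨hdom, h2.trans hle, h3.tail (step w _ _ i 1 (by rw [one_smul, add_assoc]) ?_)⟩
    have e1 := D.length_formula b (fun j hj => hc0.trans_le (hr j hj)) w y
    have e2 := D.length_formula b (fun j hj => hc0.trans_le (hr' j hj))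
      (w * weylGroup.ofIdx P i) y
    rw [← add_assoc, map_add, twoRho_coroot] at e2
    rw [← add_assoc]
    omega

theorem root_le_of_depth {l : X} {m : ℤ} (h : m ≤ D.depth b l) {i : ι} (hi : i ∈ b.support) :
    m ≤ D.root i l :=
  h.trans (ciInf_le (f := fun i : b.support => D.root i l) (Set.finite_range _).bddBelow ⟨i, hi⟩)

/-- Here `c` bounds the Cartan integers in absolute value: 3 for `G₂`, and 2 otherwise, the diagonal
value. -/
theorem exists_pairing_bound [P.IsIrreducible] (w₀ : P.weylGroup) :
    ∃ c : ℤ, 0 < c ∧ (∀ i j, P.pairingIn ℤ i j ≤ c) ∧ (∀ i j, -c ≤ P.pairingIn ℤ i j) ∧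
      c * (b.length w₀ + 1) = b.depthBound w₀ := by
  by_cases hG : P.IsG2
  · have h : ∀ i j, -3 ≤ P.pairingIn ℤ i j ∧ P.pairingIn ℤ i j ≤ 3 := by
      intro i j
      have := P.pairingIn_pairingIn_mem_set_of_isCrystal_of_isRed i j
      simp only [Set.mem_insert_iff, Set.mem_singleton_iff, Prod.mk.injEq] at this
      omega
    refine ⟨3, by norm_num, fun i j => (h i j).2, fun i j => (h i j).1, ?_⟩
    rw [Base.depthBound, if_pos hG]; ring
  · have h : ∀ i j, -2 ≤ P.pairingIn ℤ i j ∧ P.pairingIn ℤ i j ≤ 2 := by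
      intro i j
      have := (P.isNotG2_iff.1 (P.not_isG2_iff_isNotG2.1 hG)) i j
      simp only [Set.mem_insert_iff, Set.mem_singleton_iff] at this
      omega
    refine ⟨2, by norm_num, fun i j => (h i j).2, fun i j => (h i j).1, ?_⟩
    rw [Base.depthBound, if_neg hG]; ring

end CocharacterDatum
end

theorem mainTheorem3 {ι V V' X : Type*} [Finite ι] [Nonempty ι]
    [AddCommGroup V] [Module ℚ V] [AddCommGroup V'] [Module ℚ V']
    (P : RootPairing ι ℚ V V') [P.IsCrystallographic] [P.IsReduced] [P.IsIrreducible]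
    (b : P.Base) [AddCommGroup X] [DistribMulAction P.weylGroup X]
    (D : CocharacterDatum P X)
    (w₀ : P.weylGroup) (hw₀ : b.IsLongest w₀)
    (lam μ : X) (hlam : D.IsDominant b lam) (hμ : D.IsDominant b μ)
    (hdepth : ∀ lam' : X, D.IsDominant b lam' → D.DomLE b lam lam' → D.DomLE b lam' μ →
      b.depthBound w₀ ≤ D.depth b lam')
    (x y : P.weylGroup) :
    D.fin x * D.t lam * D.fin y ∈ D.Adm b μ ↔ D.QBGPath b x y⁻¹ (μ - lam) := by
  have := Fintype.ofFinite ι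
  obtain ⟨c, hc0, hc1, hc2, hc⟩ := CocharacterDatum.exists_pairing_bound b w₀
  have hd : ∀ l, D.IsDominant b l → D.DomLE b lam l → D.DomLE b l μ →
      ∀ i ∈ b.support, c * (b.length w₀ + 1) ≤ D.root i l := fun l h1 h2 h3 i hi =>
    hc ▸ D.root_le_of_depth b (hdepth l h1 h2 h3) hi
  constructor
  · rintro ⟨z, hz⟩
    exact (D.qbgPath_of_chain b (fun w => Int.ofNat_le.2 (hw₀ w)) hc1 hc0 hμ hd
      ((D.bruhatLE_iff_cov b).1 hz) hlam (D.domLE_refl b lam) rfl).2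
  · intro p
    -- The path ends at the left factor `y⁻¹` with translation part `μ`, and `y⁻¹ t^μ y = t^{y⁻¹μ}`.
    refine ⟨y⁻¹, ?_⟩
    have h := (D.bruhatLE_of_qbgPath b hc0 hc2 hlam (fun l h1 h2 h3 i hi => ?_) p y
      (by rw [add_sub_cancel]; exact D.domLE_refl b μ)).2.2
    · rwa [add_sub_cancel, CocharacterDatum.fin_mul_t_mul_fin D y⁻¹, inv_mul_cancel,
        CocharacterDatum.fin_one, mul_one] at h
    · refine le_trans ?_ (hd l h1 h2 h3 i hi)
      have : (0 : ℤ) ≤ b.length w₀ := Int.natCast_nonneg _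
      nlinarith
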